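/- Let $W(z\mid x,y)$ be a two-user discrete memoryless multiple access channel with finite input alphabets $\mathcal X,\mathcal Y$ and finite output alphabet $\mathcal Z$, and let $W^n$ be its $n$-fold memoryless extension. Call $W$ *1-spoofable* if there are conditional distributions $Q(y\mid \tilde x,\tilde y)$ on $\mathcal Y$ and $Q'(x\mid\tilde x,x')$ on $\mathcal X$ such that for all $x',\tilde x\in\mathcal X$, $\tilde y\in\mathcal Y$, $z\in\mathcal Z$, $$\sum_{y}Q(y\mid\tilde x,\tilde y)W(z\mid x',y)=\sum_{y}Q(y\mid x',\tilde y)W(z\mid\tilde x,y)=\sum_{x}Q'(x\mid\tilde x,x')W(z\mid x,\tilde y),$$ and *2-spoofable* if there are conditional distributions $Q(x\mid\tilde x,\tilde y)$ on $\mathcal X$ and $Q'(y\mid\tilde y,y')$ on $\mathcal Y$ such that for all $\tilde x\in\mathcal X$, $\tilde y,y'\in\mathcal Y$, $z\in\mathcal Z$, $$\sum_{x}Q(x\mid\tilde x,\tilde y)W(z\mid x,y')=\sum_{x}Q(x\mid\tilde x,y')W(z\mid x,\tilde y)=\sum_{y}Q'(y\mid\tilde y,y')W(z\mid\tilde x,y).$$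 A (deterministic) $(N_1,N_2,n)$ *adversary identifying code*, $N_1,N_2\ge 1$, consists of encoders $f_1:\{1,\dots,N_1\}\to\mathcal X^n$, $f_2:\{1,\dots,N_2\}\to\mathcal Y^n$ and a decoder $\phi$ which maps each $\mathbf z\in\mathcal Z^n$ to a message pair or to one of two symbols declaring that user 1, respectively user 2, is adversarial. Its error probability $P_e$ is the maximum of three quantities: (i) the average over all message pairs $(m_1,m_2)$ of the probability, under $W^n(\cdot\mid f_1(m_1),f_2(m_2))$, that $\phi$ does not output $(m_1,m_2)$; (ii) the maximum over $\mathbf x\in\mathcal X^n$ of the average over $m_2$ of the probability, under $W^n(\cdot\mid\mathbf x,f_2(m_2))$, that $\phi$ outputs neither a pair with second entry $m_2$ nor the declaration that user 1 is adversarial; (iii) the maximum over $\mathbf y\in\mathcal Y^n$ of the average over $m_1$ of the probability, under $W^n(\cdot\mid f_1(m_1),\mathbf y)$, that $\phi$ outputs neither a pair with first entry $m_1$ nor the declaration that user 2 is adversarial. In a code with *privately randomized encoders*, each encoder maps its message to a random word, independently of the other encoder, and $\phi$ is still deterministic; its error probability is defined in the same way, averaging also over the randomness of the honest encoders, the maxima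 in (ii) and (iii) being over all probability distributions of the adversarial word. A pair $(R_1,R_2)$ with $R_1,R_2\ge0$ is *achievable* if there are deterministic $(\lfloor 2^{nR_1}\rfloor,\lfloor 2^{nR_2}\rfloor,n)$ adversary identifying codes, $n\ge1$, whose error probabilities tend to $0$ as $n\to\infty$; the deterministic *capacity region* $\mathcal C\subseteq\mathbb R^2$ is the closure of the set of achievable pairs. **Theorem.** If $W$ is 1-spoofable (resp. 2-spoofable), then every $(N_1,N_2,n)$ adversary identifying code with $N_1\ge2$ (resp. $N_2\ge2$), deterministic or with privately randomized encoders, has error probability at least $1/12$. If $W$ is neither 1-spoofable nor 2-spoofable, then the deterministic capacity region $\mathcal C$ has non-empty interior; in particular some pair $(R_1,R_2)$ with $R_1>0$ and $R_2>0$ is achievable. -/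

import Mathlib

noncomputable section

namespace ByzantineMAC

/-- A conditional distribution `P(b | a)` on the finite set `B` given `a : A`. -/
structure CondDist (A B : Type*) [Fintype B] where
  prob : A → B → ℝ
  nonneg : ∀ a b, 0 ≤ prob a b
  sum_eq_one : ∀ a, ∑ b, prob a b = 1

/-- A two-user multiple access channel `W(z | x, y)`. -/
abbrev MAC (X Y Z : Type*) [Fintype Z] := CondDist (X × Y) Z

/-- The output of a decoder: either a message (pair), or the declaration that user 1 (resp. user 2)
is adversarial. -/
inductive Decision (M : Type) where
  | message (m : M)
  | blame1
  | blame2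

/-- Apply a function to the decoded message, if there is one. -/
def Decision.map {M M' : Type} (g : M → M') : Decision M → Decision M'
  | .message m => .message (g m)
  | .blame1 => .blame1
  | .blame2 => .blame2

/-- A decoder for message sets of sizes `N₁`, `N₂` and output words of length `n`. -/
abbrev Decoder (Z : Type*) (N₁ N₂ n : ℕ) := (Fin n → Z) → Decision (Fin N₁ × Fin N₂)

section Events

variable {Z : Type*} {N₁ N₂ n : ℕ}

/-- The error event when both users are honest and send `(m₁, m₂)`. -/
def errHon (φ : Decoder Z N₁ N₂ n) (m₁ : Fin N₁) (m₂ : Fin N₂) : Set (Fin n → Z) :=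
  {z | φ z ≠ .message (m₁, m₂)}

/-- The error event for the honest user 1 (message `m₁`), when user 2 is adversarial. -/
def err1 (φ : Decoder Z N₁ N₂ n) (m₁ : Fin N₁) : Set (Fin n → Z) :=
  {z | (φ z).map Prod.fst ≠ .message m₁ ∧ (φ z).map Prod.fst ≠ .blame2}

/-- The error event for the honest user 2 (message `m₂`), when user 1 is adversarial. -/
def err2 (φ : Decoder Z N₁ N₂ n) (m₂ : Fin N₂) : Set (Fin n → Z) :=
  {z | (φ z).map Prod.snd ≠ .message m₂ ∧ (φ z).map Prod.snd ≠ .blame1}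

end Events

/-- A deterministic `(N₁, N₂, n)` adversary identifying code. -/
structure DetCode (X Y Z : Type*) (N₁ N₂ n : ℕ) where
  enc1 : Fin N₁ → Fin n → X
  enc2 : Fin N₂ → Fin n → Y
  dec : Decoder Z N₁ N₂ n

/-- An `(N₁, N₂, n)` code whose encoders are privately randomized: `enc1.prob m₁ x` is the
probability that user 1 encodes the message `m₁` as the word `x`, and likewise for user 2;
the two encoders are independent. -/
structure StochCode (X Y Z : Type*) [Fintype X] [Fintype Y] (N₁ N₂ n : ℕ) where
  enc1 : CondDist (Fin N₁) (Fin n → X)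
  enc2 : CondDist (Fin N₂) (Fin n → Y)
  dec : Decoder Z N₁ N₂ n

section Channel

variable {X Y Z : Type*} [Fintype X] [Fintype Y] [Fintype Z] {N₁ N₂ n : ℕ}

/-- `Wⁿ(S | x, y)`: the probability that the output word of the memoryless channel lies in `S`. -/
def MAC.prodProb (W : MAC X Y Z) (S : Set (Fin n → Z)) (x : Fin n → X) (y : Fin n → Y) : ℝ :=
  ∑ z : Fin n → Z, S.indicator (fun z => ∏ t, W.prob (x t, y t) (z t)) z

/-- Average error probability of a deterministic code, both users honest. -/
def DetCode.errorHon (c : DetCode X Y Z N₁ N₂ n) (W : MAC X Y Z) : ℝ :=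
  1 / ((N₁ : ℝ) * N₂) *
    ∑ m₁, ∑ m₂, MAC.prodProb W (errHon c.dec m₁ m₂) (c.enc1 m₁) (c.enc2 m₂)

/-- Average error probability of a deterministic code, user 1 adversarial. -/
def DetCode.errorMal1 (c : DetCode X Y Z N₁ N₂ n) (W : MAC X Y Z) : ℝ :=
  ⨆ x : Fin n → X, 1 / (N₂ : ℝ) * ∑ m₂, MAC.prodProb W (err2 c.dec m₂) x (c.enc2 m₂)

/-- Average error probability of a deterministic code, user 2 adversarial. -/
def DetCode.errorMal2 (c : DetCode X Y Z N₁ N₂ n) (W : MAC X Y Z) : ℝ :=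
  ⨆ y : Fin n → Y, 1 / (N₁ : ℝ) * ∑ m₁, MAC.prodProb W (err1 c.dec m₁) (c.enc1 m₁) y

/-- The average probability of error of a deterministic code. -/
def DetCode.error (c : DetCode X Y Z N₁ N₂ n) (W : MAC X Y Z) : ℝ :=
  max (c.errorHon W) (max (c.errorMal1 W) (c.errorMal2 W))

/-- Average error probability of a privately randomized code, both users honest. -/
def StochCode.errorHon (c : StochCode X Y Z N₁ N₂ n) (W : MAC X Y Z) : ℝ :=
  1 / ((N₁ : ℝ) * N₂) *
    ∑ m₁, ∑ m₂, ∑ x, ∑ y, c.enc1.prob m₁ x * c.enc2.prob m₂ y *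
      MAC.prodProb W (errHon c.dec m₁ m₂) x y

/-- Average error probability of a privately randomized code, user 1 adversarial: the maximum over
all (randomized) attacks. -/
def StochCode.errorMal1 (c : StochCode X Y Z N₁ N₂ n) (W : MAC X Y Z) : ℝ :=
  ⨆ p : stdSimplex ℝ (Fin n → X), ∑ x, (p : (Fin n → X) → ℝ) x *
    (1 / (N₂ : ℝ) * ∑ m₂, ∑ y, c.enc2.prob m₂ y * MAC.prodProb W (err2 c.dec m₂) x y)

/-- Average error probability of a privately randomized code, user 2 adversarial: the maximum over
all (randomized) attacks. -/
def StochCode.errorMal2 (c : StochCode X Y Z N₁ N₂ n) (W : MAC X Y Z) : ℝ :=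
  ⨆ p : stdSimplex ℝ (Fin n → Y), ∑ y, (p : (Fin n → Y) → ℝ) y *
    (1 / (N₁ : ℝ) * ∑ m₁, ∑ x, c.enc1.prob m₁ x * MAC.prodProb W (err1 c.dec m₁) x y)

/-- The average probability of error of a privately randomized code. -/
def StochCode.error (c : StochCode X Y Z N₁ N₂ n) (W : MAC X Y Z) : ℝ :=
  max (c.errorHon W) (max (c.errorMal1 W) (c.errorMal2 W))

/-- The channel is 1-spoofable. -/
def Spoofable1 (W : MAC X Y Z) : Prop :=
  ∃ (Q : CondDist (X × Y) Y) (Q' : CondDist (X × X) X), ∀ (x' xt : X) (yt : Y) (z : Z),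
    ∑ y, Q.prob (xt, yt) y * W.prob (x', y) z = ∑ y, Q.prob (x', yt) y * W.prob (xt, y) z ∧
    ∑ y, Q.prob (x', yt) y * W.prob (xt, y) z = ∑ x, Q'.prob (xt, x') x * W.prob (x, yt) z

/-- The channel is 2-spoofable. -/
def Spoofable2 (W : MAC X Y Z) : Prop :=
  ∃ (Q : CondDist (X × Y) X) (Q' : CondDist (Y × Y) Y), ∀ (xt : X) (yt y' : Y) (z : Z),
    ∑ x, Q.prob (xt, yt) x * W.prob (x, y') z = ∑ x, Q.prob (xt, y') x * W.prob (x, yt) z ∧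
    ∑ x, Q.prob (xt, y') x * W.prob (x, yt) z = ∑ y, Q'.prob (yt, y') y * W.prob (xt, y) z

/-- `(R₁, R₂)` is achievable with deterministic codes. Rates are non-negative, so that
there is always at least one message per user. -/
def Achievable (W : MAC X Y Z) (R : ℝ × ℝ) : Prop :=
  0 ≤ R.1 ∧ 0 ≤ R.2 ∧
    ∃ c : ∀ n : ℕ, DetCode X Y Z ⌊(2 : ℝ) ^ ((n : ℝ) * R.1)⌋₊ ⌊(2 : ℝ) ^ ((n : ℝ) * R.2)⌋₊ n,
      Filter.Tendsto (fun n => (c n).error W) Filter.atTop (nhds 0)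

/-- The deterministic capacity region of communication with adversary identification. -/
def capacityRegion (W : MAC X Y Z) : Set (ℝ × ℝ) :=
  closure {R | Achievable W R}

end Channel

end ByzantineMAC

end

/-! Converse. Let user 1 hold codewords `x'`, `xt` of messages `m ≠ m'`, and user 2 a codeword `yt`
of `k`. The three members of the spoofing equations are the output laws of three scenarios: user 1
honest with `x'`, user 1 honest with `xt` (user 2 attacking through `Q` in both), and user 2 honest
with `yt` (user 1 attacking through `Q'`). These laws coincide, and each decoder output is wrong in
at least one scenario, so the three error probabilities add up to at least 1. Averaging over
independent messages, which differ with probability at least 1/2, bounds the code error from below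
(`Spoofable1.le_of_attack_le`). The 2-spoofable case follows by exchanging the users.

Achievability. One codebook `F` over the alphabet `X × Y` is indexed by the messages of both users;
each user sends the corresponding coordinate of its words. A random `F` of small enough rate is
decorrelated: each word is nearly uniform relative to the joint type of any five others
(`exists_decorrelated`). An index is a candidate for the output `z` if some word `o` of the other
user explains `z`, with the candidate's word nearly uniform relative to `o` and any two other
codewords. The decoder outputs a pair of candidates, and blames a user who has none.

True messages are candidates. If many codewords correlated with one fixed word `o`, then nearly
orthogonal vectors would all correlate with one bounded vector, which Cauchy–Schwarz forbids
(`card_mul_sq_le_of_gram`). So for every `o`, without any union bound over attacks, all but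
boundedly many messages are unbiased, and for these the Hoeffding bound gives acceptance
(`sum_prodProb_not_candidate_le`). At positive rates the exceptional messages have vanishing weight.

Candidates are unique. Two candidates of one user and one of the other give three expressions for
the joint type of their words and `z`. Equating them solves the spoofing equations up to a small
error, whereas by compactness a channel that is not spoofable violates them by a fixed amount
(`Candidate.not_confused`, `exists_le_spoofDefect`). -/

noncomputable section

namespace ByzantineMAC

/-! ### Real-valued indicators. -/

section Indicator

open scoped Classical in
/-- The real-valued indicator of a proposition. -/
def ind (p : Prop) : ℝ := if p then 1 else 0

lemma ind_of_true {p : Prop} (h : p) : ind p = 1 := if_pos h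

lemma ind_of_false {p : Prop} (h : ¬ p) : ind p = 0 := if_neg h

lemma ind_nonneg (p : Prop) : 0 ≤ ind p := by
  by_cases h : p <;> simp [ind, h]

lemma ind_le_one (p : Prop) : ind p ≤ 1 := by
  by_cases h : p <;> simp [ind, h]

lemma abs_ind_le_one (p : Prop) : |ind p| ≤ 1 := by
  rw [abs_of_nonneg (ind_nonneg p)]; exact ind_le_one p

lemma ind_mul_ind (p q : Prop) : ind p * ind q = ind (p ∧ q) := by
  by_cases hp : p <;> by_cases hq : q <;> simp [ind, hp, hq]

lemma ind_mono {p q : Prop} (h : p → q) : ind p ≤ ind q := by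
  by_cases hp : p
  · rw [ind_of_true hp, ind_of_true (h hp)]
  · rw [ind_of_false hp]; exact ind_nonneg q

lemma ind_or_le (p q : Prop) : ind (p ∨ q) ≤ ind p + ind q := by
  by_cases hp : p <;> by_cases hq : q <;> simp [ind, hp, hq]

lemma sum_ind_eq_mul {α : Type*} [Fintype α] (x : α) (f : α → ℝ) :
    ∑ a, ind (x = a) * f a = f x := by
  classical
  simp [ind]

lemma sum_ind_eq {α : Type*} [Fintype α] (x : α) : ∑ a, ind (x = a) = 1 := by
  simpa using sum_ind_eq_mul x (fun _ => 1)

lemma ind_exists_le {α : Type*} [Fintype α] (p : α → Prop) : ind (∃ a, p a) ≤ ∑ a, ind (p a) := by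
  by_cases h : ∃ a, p a
  · obtain ⟨a, ha⟩ := h
    rw [ind_of_true ⟨a, ha⟩, ← ind_of_true ha]
    exact Finset.single_le_sum (f := fun a => ind (p a)) (fun a _ => ind_nonneg _)
      (Finset.mem_univ a)
  · rw [ind_of_false h]
    exact Finset.sum_nonneg fun a _ => ind_nonneg _

lemma abs_ind_sub_inv_card_le_one (p : Prop) (k : ℕ) : |ind p - 1 / (k : ℝ)| ≤ 1 := by
  have h0 : (0 : ℝ) ≤ 1 / (k : ℝ) := by positivity
  have h1 : 1 / (k : ℝ) ≤ 1 := by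
    rcases Nat.eq_zero_or_pos k with rfl | hk
    · simp
    · rw [div_le_one (by positivity)]; exact_mod_cast hk
  have := ind_nonneg p
  have := ind_le_one p
  rw [abs_le]; constructor <;> linarith

end Indicator

/-! ### Hoeffding-type bounds for finite product distributions. -/

section Concentration

variable {B : Type*} [Fintype B] {n : ℕ}

lemma sum_prod_eq_prod_sum (f : Fin n → B → ℝ) :
    ∑ z : Fin n → B, ∏ t, f t (z t) = ∏ t, ∑ b, f t b := by
  classical
  rw [Finset.prod_univ_sum, Fintype.piFinset_univ]

/-- The quadratic estimate `exp x ≤ 1 + x + x ^ 2` for `|x| ≤ 1` is averaged; the linear term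
vanishes because `h` has mean zero. -/
lemma sum_mul_exp_le {p h : B → ℝ} (hp : ∀ b, 0 ≤ p b) (hs : ∑ b, p b = 1)
    (hh : ∀ b, |h b| ≤ 1) (hm : ∑ b, p b * h b = 0) {l : ℝ} (hl : |l| ≤ 1) :
    ∑ b, p b * Real.exp (l * h b) ≤ Real.exp (l ^ 2) := by
  have key : ∀ b, p b * Real.exp (l * h b) ≤ p b * (1 + l * h b + l ^ 2) := by
    intro b
    refine mul_le_mul_of_nonneg_left ?_ (hp b)
    have h1 : |l * h b| ≤ 1 := by
      rw [abs_mul]; exact mul_le_one₀ hl (abs_nonneg _) (hh b)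
    have h2 := (abs_le.1 (Real.abs_exp_sub_one_sub_id_le h1)).2
    have h3 : (l * h b) ^ 2 ≤ l ^ 2 := by
      rw [mul_pow]
      have : h b ^ 2 ≤ 1 := by rw [sq_le_one_iff_abs_le_one]; exact hh b
      nlinarith [sq_nonneg l]
    linarith
  calc ∑ b, p b * Real.exp (l * h b) ≤ ∑ b, p b * (1 + l * h b + l ^ 2) :=
        Finset.sum_le_sum fun b _ => key b
    _ = ∑ b, (p b * (1 + l ^ 2) + l * (p b * h b)) := by
        refine Finset.sum_congr rfl fun b _ => by ring
    _ = 1 + l ^ 2 := by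
        rw [Finset.sum_add_distrib, ← Finset.sum_mul, ← Finset.mul_sum, hs, hm]; ring
    _ ≤ Real.exp (l ^ 2) := by linarith [Real.add_one_le_exp (l ^ 2)]

/-- Exponential Markov inequality with parameter `e / 2`, which is optimal for the moment bound `exp
(l ^ 2)`. The condition `e ≤ 2` keeps this parameter in the range of `sum_mul_exp_le`. -/
lemma product_tail_le {p h : Fin n → B → ℝ} (hp : ∀ t b, 0 ≤ p t b) (hs : ∀ t, ∑ b, p t b = 1)
    (hh : ∀ t b, |h t b| ≤ 1) (hm : ∀ t, ∑ b, p t b * h t b = 0) {e : ℝ} (he : 0 ≤ e)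
    (he2 : e ≤ 2) :
    ∑ z : Fin n → B, ind (e * n < ∑ t, h t (z t)) * ∏ t, p t (z t) ≤
      Real.exp (-(n * e ^ 2 / 4)) := by
  have hl : |e / 2| ≤ 1 := by rw [abs_of_nonneg (by linarith)]; linarith
  calc ∑ z : Fin n → B, ind (e * n < ∑ t, h t (z t)) * ∏ t, p t (z t)
      ≤ ∑ z : Fin n → B, Real.exp (-(e / 2 * (e * n))) *
          ∏ t, (p t (z t) * Real.exp (e / 2 * h t (z t))) := by
        refine Finset.sum_le_sum fun z _ => ?_
        rw [Finset.prod_mul_distrib, ← Real.exp_sum, ← Finset.mul_sum, mul_comm (∏ t, p t (z t)),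
          ← mul_assoc, ← Real.exp_add]
        refine mul_le_mul_of_nonneg_right ?_ (Finset.prod_nonneg fun t _ => hp t _)
        by_cases hc : e * n < ∑ t, h t (z t)
        · rw [ind_of_true hc]
          refine Real.one_le_exp ?_
          nlinarith
        · rw [ind_of_false hc]; exact (Real.exp_pos _).le
    _ = Real.exp (-(e / 2 * (e * n))) * ∏ t, ∑ b, p t b * Real.exp (e / 2 * h t b) := by
        rw [← Finset.mul_sum, sum_prod_eq_prod_sum (fun t b => p t b * Real.exp (e / 2 * h t b))]
    _ ≤ Real.exp (-(e / 2 * (e * n))) * ∏ _t : Fin n, Real.exp ((e / 2) ^ 2) := by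
        refine mul_le_mul_of_nonneg_left ?_ (Real.exp_pos _).le
        refine Finset.prod_le_prod (fun t _ => Finset.sum_nonneg fun b _ =>
          mul_nonneg (hp t b) (Real.exp_pos _).le) fun t _ => ?_
        exact sum_mul_exp_le (hp t) (hs t) (hh t) (hm t) hl
    _ = Real.exp (-(n * e ^ 2 / 4)) := by
        rw [Finset.prod_const, Finset.card_univ, Fintype.card_fin, ← Real.exp_nat_mul,
          ← Real.exp_add]
        congr 1; ring

/-- A two-sided Hoeffding bound for a finite product distribution. -/
lemma product_abs_tail_le {p h : Fin n → B → ℝ} (hp : ∀ t b, 0 ≤ p t b)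
    (hs : ∀ t, ∑ b, p t b = 1) (hh : ∀ t b, |h t b| ≤ 1) (hm : ∀ t, ∑ b, p t b * h t b = 0)
    {e : ℝ} (he : 0 ≤ e) (he2 : e ≤ 2) :
    ∑ z : Fin n → B, ind (e * n < |∑ t, h t (z t)|) * ∏ t, p t (z t) ≤
      2 * Real.exp (-(n * e ^ 2 / 4)) := by
  have h1 := product_tail_le hp hs hh hm he he2
  have h2 := product_tail_le (h := fun t b => - h t b) hp hs (by simpa using hh)
    (by simpa using hm) he he2
  rw [two_mul]
  refine le_trans ?_ (add_le_add h1 h2)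
  rw [← Finset.sum_add_distrib]
  refine Finset.sum_le_sum fun z _ => ?_
  rw [← add_mul]
  refine mul_le_mul_of_nonneg_right ?_ (Finset.prod_nonneg fun t _ => hp t _)
  refine le_trans (ind_mono fun hc => ?_) (ind_or_le _ _)
  rw [Finset.sum_neg_distrib]
  exact lt_abs.1 hc

end Concentration

/-! ### Decorrelated codebooks by random choice. -/

section Codebook

variable {A M : Type*} [Fintype A] {n k : ℕ}

/-- Every word of the codebook `F` is nearly uncorrelated with any `k` other words. -/
def Decorrelated (k : ℕ) (F : M → Fin n → A) (κ : ℝ) : Prop :=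
  ∀ (i : M) (J : Fin k → M), (∀ r, J r ≠ i) → ∀ (a : A) (τ : Fin k → A),
    |∑ t, (ind (F i t = a) - 1 / (Fintype.card A : ℝ)) * ind (∀ r, F (J r) t = τ r)| ≤ κ * n

/-- Exchanging the word `F i` with the fresh word `w` is an involution of the pairs `(F, w)`. Thus
resampling one word of a uniform codebook leaves its distribution unchanged. -/
lemma sum_update [Fintype M] {V : Type*} [Fintype V] [DecidableEq M] (i : M) (f : (M → V) → ℝ) :
    ∑ F : M → V, ∑ w, f (Function.update F i w) = Fintype.card V * ∑ F : M → V, f F := by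
  let e : (M → V) × V ≃ (M → V) × V := 
    { toFun := fun q => (Function.update q.1 i q.2, q.1 i)
      invFun := fun q => (Function.update q.1 i q.2, q.1 i)
      left_inv := fun q => by simp
      right_inv := fun q => by simp }
  have h := Equiv.sum_comp e (fun q => f q.1)
  rw [Fintype.sum_prod_type, Fintype.sum_prod_type] at h
  simp only [e, Equiv.coe_fn_mk] at h
  rw [h, Finset.sum_congr rfl fun F _ => Finset.sum_const (f F), Finset.mul_sum]
  simp

lemma sum_ind_word_le [Nonempty A] (a : A) (g : Fin n → ℝ) (hg : ∀ t, |g t| ≤ 1) {κ : ℝ}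
    (h0 : 0 ≤ κ) (h2 : κ ≤ 2) :
    ∑ w : Fin n → A, ind (κ * n < |∑ t, (ind (w t = a) - 1 / (Fintype.card A : ℝ)) * g t|) ≤
      Fintype.card (Fin n → A) * (2 * Real.exp (-(n * κ ^ 2 / 4))) := by
  have hc : (Fintype.card A : ℝ) ≠ 0 := by exact_mod_cast Fintype.card_ne_zero
  have h := product_abs_tail_le (n := n) (B := A) (p := fun _ _ => 1 / (Fintype.card A : ℝ))
    (h := fun t b => (ind (b = a) - 1 / (Fintype.card A : ℝ)) * g t)
    (fun _ _ => by positivity) (fun _ => by simp [hc])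
    (fun t b => by
      rw [abs_mul]
      exact mul_le_one₀ (abs_ind_sub_inv_card_le_one _ _) (abs_nonneg _) (hg t))
    (fun t => by
      rw [← Finset.mul_sum, ← Finset.sum_mul, Finset.sum_sub_distrib,
        Finset.sum_congr rfl fun b _ => by rw [eq_comm (a := b)], sum_ind_eq]
      simp [hc]) h0 h2
  simp only [Finset.prod_const, Finset.card_univ, Fintype.card_fin] at h
  rw [← Finset.sum_mul] at h
  rw [Fintype.card_fun, Fintype.card_fin]
  push_cast
  have hp : (0 : ℝ) < (Fintype.card A : ℝ) ^ n := by positivity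
  rw [one_div, inv_pow, ← div_eq_mul_inv, div_le_iff₀ hp] at h
  rw [one_div]
  exact h.trans_eq (mul_comm _ _)

/-- A random codebook is decorrelated with positive probability. -/
lemma exists_decorrelated [Fintype M] [Nonempty A] {κ : ℝ} (h0 : 0 ≤ κ) (h2 : κ ≤ 2)
    (hn : (Fintype.card M : ℝ) ^ (k + 1) * (Fintype.card A : ℝ) ^ (k + 1) *
      (2 * Real.exp (-(n * κ ^ 2 / 4))) < 1) :
    ∃ F : M → Fin n → A, Decorrelated k F κ := by
  classical
  by_contra hno
  push Not at hno
  set ρ : ℝ := 2 * Real.exp (-(n * κ ^ 2 / 4)) with hρ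
  set N : ℝ := (Fintype.card (M → Fin n → A) : ℝ) with hN
  have hNpos : 0 < N := by
    rw [hN]; exact_mod_cast Fintype.card_pos
  let bad (q : M × (Fin k → M) × A × (Fin k → A)) (F : M → Fin n → A) : Prop :=
    (∀ r, q.2.1 r ≠ q.1) ∧ κ * n < |∑ t, (ind (F q.1 t = q.2.2.1) - 1 / (Fintype.card A : ℝ)) *
      ind (∀ r, F (q.2.1 r) t = q.2.2.2 r)|
  have hbad : ∀ q, ∑ F, ind (bad q F) ≤ N * ρ := by
    intro q
    by_cases hq : ∀ r, q.2.1 r ≠ q.1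
    · have hWpos : (0 : ℝ) < Fintype.card (Fin n → A) := by exact_mod_cast Fintype.card_pos
      have h1 := sum_update q.1 (fun F => ind (bad q F))
      -- All words but the one with index `q.1` are frozen. Since `q.2.1` avoids this index, the
      -- second factor does not depend on the resampled word, and the tail bound for a single
      -- uniform word applies.
      have h3 : ∑ F : M → Fin n → A, ∑ w, ind (bad q (Function.update F q.1 w)) ≤
          ∑ _F : M → Fin n → A, Fintype.card (Fin n → A) * ρ := by
        refine Finset.sum_le_sum fun F _ => ?_
        refine le_trans (Finset.sum_le_sum fun w _ => ind_mono fun hb => ?_)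
          (sum_ind_word_le q.2.2.1 (fun t => ind (∀ r, F (q.2.1 r) t = q.2.2.2 r))
            (fun t => abs_ind_le_one _) h0 h2)
        have := hb.2
        simpa [Function.update_of_ne (hq _)] using this
      rw [h1, Finset.sum_const, Finset.card_univ, nsmul_eq_mul, ← hN] at h3
      have h4 : (Fintype.card (Fin n → A) : ℝ) * ∑ F, ind (bad q F) ≤
          Fintype.card (Fin n → A) * (N * ρ) := by linarith
      exact le_of_mul_le_mul_left h4 hWpos
    · have : ∀ F, ind (bad q F) = 0 := fun F => ind_of_false fun h => hq h.1
      simp only [this, Finset.sum_const_zero]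
      positivity
  have hall : ∀ F, 1 ≤ ∑ q, ind (bad q F) := by
    intro F
    have h := hno F
    unfold Decorrelated at h
    push Not at h
    obtain ⟨i, J, hJ, a, τ, h⟩ := h
    rw [← ind_of_true (p := ∃ q, bad q F) ⟨(i, J, a, τ), hJ, h⟩]
    exact ind_exists_le _
  have h1 : N ≤ ∑ F, ∑ q, ind (bad q F) := by
    calc N = ∑ _F : M → Fin n → A, (1 : ℝ) := by simp [hN]
      _ ≤ _ := Finset.sum_le_sum fun F _ => hall F
  rw [Finset.sum_comm] at h1
  have h3 := h1.trans (Finset.sum_le_sum fun q _ => hbad q)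
  rw [Finset.sum_const, Finset.card_univ, nsmul_eq_mul] at h3
  simp only [Fintype.card_prod, Fintype.card_fun, Fintype.card_fin] at h3
  push_cast at h3
  have h4 : N * ((Fintype.card M : ℝ) ^ (k + 1) * (Fintype.card A : ℝ) ^ (k + 1) * ρ) < N * 1 :=
    mul_lt_mul_of_pos_left hn hNpos
  have h5 : (Fintype.card M : ℝ) * (Fintype.card M ^ k * (Fintype.card A * Fintype.card A ^ k)) *
      (N * ρ) = N * ((Fintype.card M : ℝ) ^ (k + 1) * (Fintype.card A : ℝ) ^ (k + 1) * ρ) := by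
    ring
  linarith

/-- Both functions are expanded in indicators, giving `|A| ^ (k + 1)` terms of size at most `κ * n`.
Centring the indicators of `f` costs nothing because `f` sums to zero. -/
lemma Decorrelated.abs_sum_le {F : M → Fin n → A} {κ : ℝ} (hF : Decorrelated k F κ)
    {i : M} {J : Fin k → M} (hJ : ∀ r, J r ≠ i) {f : A → ℝ} (hf : ∀ a, |f a| ≤ 1)
    (hf0 : ∑ a, f a = 0) {g : (Fin k → A) → ℝ} (hg : ∀ τ, |g τ| ≤ 1) :
    |∑ t, f (F i t) * g (fun r => F (J r) t)| ≤ (Fintype.card A : ℝ) ^ (k + 1) * κ * n := by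
  classical
  have h1 : ∀ t, f (F i t) * g (fun r => F (J r) t) = ∑ a, ∑ τ, f a * g τ *
      ((ind (F i t = a) - 1 / (Fintype.card A : ℝ)) * ind (∀ r, F (J r) t = τ r)) := by
    intro t
    have e1 : f (F i t) = ∑ a, (ind (F i t = a) - 1 / (Fintype.card A : ℝ)) * f a := by
      simp only [sub_mul, Finset.sum_sub_distrib, sum_ind_eq_mul, ← Finset.mul_sum, hf0]
      simp
    have e2 : g (fun r => F (J r) t) = ∑ τ, ind (∀ r, F (J r) t = τ r) * g τ := by
      rw [← sum_ind_eq_mul (fun r => F (J r) t) g]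
      refine Finset.sum_congr rfl fun τ _ => ?_
      rw [funext_iff]
    rw [e1, e2, Finset.sum_mul_sum]
    refine Finset.sum_congr rfl fun a _ => Finset.sum_congr rfl fun τ _ => by ring
  simp only [h1]
  rw [Finset.sum_comm]
  calc |∑ a, ∑ t, ∑ τ, f a * g τ *
      ((ind (F i t = a) - 1 / (Fintype.card A : ℝ)) * ind (∀ r, F (J r) t = τ r))|
      ≤ ∑ a : A, ∑ τ : Fin k → A, κ * n := by
        refine (Finset.abs_sum_le_sum_abs _ _).trans (Finset.sum_le_sum fun a _ => ?_)
        rw [Finset.sum_comm]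
        refine (Finset.abs_sum_le_sum_abs _ _).trans (Finset.sum_le_sum fun τ _ => ?_)
        rw [← Finset.mul_sum, abs_mul, abs_mul]
        have h2 := hF i J hJ a τ
        calc |f a| * |g τ| * _ ≤ 1 * _ :=
              mul_le_mul_of_nonneg_right (mul_le_one₀ (hf a) (abs_nonneg _) (hg τ)) (abs_nonneg _)
          _ ≤ κ * n := by rw [one_mul]; exact h2
    _ = (Fintype.card A : ℝ) ^ (k + 1) * κ * n := by
        simp; ring

end Codebook

/-! ### Nearly orthogonal vectors against one bounded vector. -/

section NearOrthogonality

variable {n : ℕ}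

/-- A bounded vector cannot correlate with many nearly orthogonal vectors. -/
lemma card_mul_sq_le_of_gram {ι : Type*} (I : Finset ι) (v : ι → Fin n → ℝ) (w : Fin n → ℝ)
    (hw : ∀ t, |w t| ≤ 1) {c B : ℝ} (hc : 0 ≤ c) (hB : 0 ≤ B) (hn : 0 < n)
    (h1 : ∀ i ∈ I, c * n ≤ |∑ t, v i t * w t|)
    (h2 : ∀ i ∈ I, ∑ j ∈ I, |∑ t, v i t * v j t| ≤ B * n) : (I.card : ℝ) * c ^ 2 ≤ B := by
  have hs : ∀ x : ℝ, ∃ s : ℝ, |s| ≤ 1 ∧ s * x = |x| := by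
    intro x
    rcases le_total 0 x with h | h
    · exact ⟨1, by simp, by rw [abs_of_nonneg h, one_mul]⟩
    · exact ⟨-1, by simp, by rw [abs_of_nonpos h, neg_one_mul]⟩
  choose s hs1 hs2 using hs
  -- The signs make all correlations with `w` add up, so the signed sum of the vectors has large
  -- inner product with `w`, while the Gram bound keeps its norm small.
  set σ : ι → ℝ := fun i => s (∑ t, v i t * w t) with hσ
  have hlow : (I.card : ℝ) * (c * n) ≤ ∑ t, (∑ i ∈ I, σ i * v i t) * w t := by
    calc (I.card : ℝ) * (c * n) = ∑ _i ∈ I, c * n := by simp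
      _ ≤ ∑ i ∈ I, |∑ t, v i t * w t| := Finset.sum_le_sum h1
      _ = ∑ i ∈ I, ∑ t, σ i * v i t * w t := by
          refine Finset.sum_congr rfl fun i _ => ?_
          rw [← hs2, Finset.mul_sum]
          exact Finset.sum_congr rfl fun t _ => by rw [hσ, mul_assoc]
      _ = _ := by
          rw [Finset.sum_comm]
          exact Finset.sum_congr rfl fun t _ => by rw [Finset.sum_mul]
  have hcs := Finset.sum_mul_sq_le_sq_mul_sq Finset.univ (fun t => ∑ i ∈ I, σ i * v i t) w
  have hw2 : ∑ t, w t ^ 2 ≤ n := by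
    calc ∑ t, w t ^ 2 ≤ ∑ _t : Fin n, (1 : ℝ) :=
          Finset.sum_le_sum fun t _ => (sq_le_one_iff_abs_le_one _).2 (hw t)
      _ = n := by simp
  have hgram : ∑ t, (∑ i ∈ I, σ i * v i t) ^ 2 ≤ I.card * (B * n) := by
    calc ∑ t, (∑ i ∈ I, σ i * v i t) ^ 2
        = ∑ i ∈ I, ∑ j ∈ I, σ i * σ j * ∑ t, v i t * v j t := by
          have h0 : ∀ t, (∑ i ∈ I, σ i * v i t) ^ 2 =
              ∑ i ∈ I, ∑ j ∈ I, σ i * σ j * (v i t * v j t) := fun t => by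
            rw [sq, Finset.sum_mul_sum]
            exact Finset.sum_congr rfl fun i _ => Finset.sum_congr rfl fun j _ => by ring
          simp only [h0, Finset.mul_sum]
          rw [Finset.sum_comm]
          refine Finset.sum_congr rfl fun i _ => ?_
          rw [Finset.sum_comm]
      _ ≤ ∑ i ∈ I, ∑ j ∈ I, |∑ t, v i t * v j t| := by
          refine Finset.sum_le_sum fun i _ => Finset.sum_le_sum fun j _ => ?_
          refine (le_abs_self _).trans ?_
          rw [abs_mul, abs_mul]
          exact mul_le_of_le_one_left (abs_nonneg _)
            (mul_le_one₀ (hs1 _) (abs_nonneg _) (hs1 _))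
      _ ≤ ∑ _i ∈ I, B * n := Finset.sum_le_sum h2
      _ = _ := by simp
  have hnp : (0 : ℝ) < n := by exact_mod_cast hn
  rcases Nat.eq_zero_or_pos I.card with h0 | h0
  · rw [h0]; simpa using hB
  have hk : (0 : ℝ) < I.card := by exact_mod_cast h0
  have h3 : ((I.card : ℝ) * (c * n)) ^ 2 ≤ I.card * (B * n) * n :=
    calc ((I.card : ℝ) * (c * n)) ^ 2 ≤ (∑ t, (∑ i ∈ I, σ i * v i t) * w t) ^ 2 :=
          pow_le_pow_left₀ (by positivity) hlow 2
      _ ≤ _ := hcs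
      _ ≤ _ := mul_le_mul hgram hw2 (Finset.sum_nonneg fun t _ => sq_nonneg _) (by positivity)
  have h4 : ((I.card : ℝ) * n ^ 2) * (I.card * c ^ 2) ≤ (I.card * n ^ 2) * B := by
    nlinarith
  exact le_of_mul_le_mul_left h4 (by positivity)

end NearOrthogonality

/-! ### Only boundedly many codewords are biased relative to a given word. -/

section Bias

variable {A H O M : Type*} [Fintype A] [Fintype H] {n : ℕ}

/-- The letters of the word `π ∘ F i` are nearly uniform, given those of `o` and of any two other
words of the codebook. -/
def Unbiased (π : A → H) (F : M → Fin n → A) (o : Fin n → O) (e : ℝ) (i : M) : Prop :=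
  ∀ u v, u ≠ i → v ≠ i → ∀ (a : H) (d : O) (G : Set (A × A)),
    |∑ t, (ind (π (F i t) = a) - 1 / (Fintype.card H : ℝ)) *
      (ind (o t = d) * ind ((F u t, F v t) ∈ G))| ≤ e * n

/-- A biased `i` comes with witnesses `u i`, `v i`. The vectors `x i` made from the three words all
correlate with the indicator of `o t = d`, yet are nearly orthogonal to each other, so there are few
of them. The hypothesis `hπ` says that `π` maps the uniform distribution to the uniform one. -/
lemma card_biased_letter_le [Fintype M] {π : A → H}
    (hπ : ∀ h, ∑ α, (ind (π α = h) - 1 / (Fintype.card H : ℝ)) = 0)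
    {F : M → Fin n → A} {κ e : ℝ} (hF : Decorrelated 5 F κ) (he : 0 < e)
    (hκ : (Fintype.card A : ℝ) ^ 6 * κ ≤ e ^ 2 / 2) (hn : 0 < n) (o : Fin n → O)
    (a : H) (d : O) (G : Set (A × A)) (I : Finset M)
    (hI : ∀ i ∈ I, ∃ u v, u ≠ i ∧ v ≠ i ∧
      e * n < |∑ t, (ind (π (F i t) = a) - 1 / (Fintype.card H : ℝ)) *
        (ind (o t = d) * ind ((F u t, F v t) ∈ G))|) :
    (I.card : ℝ) ≤ 6 / e ^ 2 := by
  classical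
  choose! u v hu hv huv using hI
  let x : M → Fin n → ℝ := fun i t => (ind (π (F i t) = a) - 1 / (Fintype.card H : ℝ)) *
    ind ((F (u i) t, F (v i) t) ∈ G)
  have hx1 : ∀ i t, |x i t| ≤ 1 := fun i t => by
    rw [abs_mul]
    exact mul_le_one₀ (abs_ind_sub_inv_card_le_one _ _) (abs_nonneg _) (abs_ind_le_one _)
  have hnp : (0 : ℝ) < n := by exact_mod_cast hn
  have hgram : ∀ i, ∀ j ∈ I, |∑ t, x i t * x j t| ≤
      (ind (i = j) + ind (u i = j) + ind (v i = j)) * n + e ^ 2 / 2 * n := by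
    intro i j hj
    have := ind_nonneg (i = j)
    have := ind_nonneg (u i = j)
    have := ind_nonneg (v i = j)
    by_cases hc : i = j ∨ u i = j ∨ v i = j
    · have h1 : 1 ≤ ind (i = j) + ind (u i = j) + ind (v i = j) := by
        rcases hc with h | h | h <;> · have := ind_of_true h; linarith
      have h2 : |∑ t, x i t * x j t| ≤ n := by
        calc |∑ t, x i t * x j t| ≤ ∑ t, |x i t * x j t| := Finset.abs_sum_le_sum_abs _ _
          _ ≤ ∑ _t : Fin n, (1 : ℝ) := Finset.sum_le_sum fun t _ => by
              rw [abs_mul]; exact mul_le_one₀ (hx1 _ _) (abs_nonneg _) (hx1 _ _)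
          _ = n := by simp
      have h3 : 0 ≤ e ^ 2 / 2 * n := by positivity
      nlinarith
    · push Not at hc
      obtain ⟨hc1, hc2, hc3⟩ := hc
      -- The product of `x i` and `x j` involves word `j` and five others, which is why
      -- decorrelation is required for `k = 5`. It applies as soon as `j` is none of `i`, `u i`, `v
      -- i`.
      have h := hF.abs_sum_le (i := j) (J := ![i, u i, v i, u j, v j])
        (by intro r; fin_cases r <;> simp [*])
        (f := fun α => ind (π α = a) - 1 / (Fintype.card H : ℝ))
        (fun α => abs_ind_sub_inv_card_le_one _ _) (hπ a)
        (g := fun τ => (ind (π (τ 0) = a) - 1 / (Fintype.card H : ℝ)) *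
          (ind ((τ 1, τ 2) ∈ G) * ind ((τ 3, τ 4) ∈ G)))
        (fun τ => by
          rw [abs_mul, abs_mul]
          exact mul_le_one₀ (abs_ind_sub_inv_card_le_one _ _) (by positivity)
            (mul_le_one₀ (abs_ind_le_one _) (abs_nonneg _) (abs_ind_le_one _)))
      have h1 : ∑ t, x i t * x j t = ∑ t, (ind (π (F j t) = a) - 1 / (Fintype.card H : ℝ)) *
          ((ind (π (F i t) = a) - 1 / (Fintype.card H : ℝ)) *
          (ind ((F (u i) t, F (v i) t) ∈ G) * ind ((F (u j) t, F (v j) t) ∈ G))) :=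
        Finset.sum_congr rfl fun t _ => by simp only [x]; ring
      rw [h1]
      refine le_trans h ?_
      have h2 : (Fintype.card A : ℝ) ^ (5 + 1) * κ * n ≤ e ^ 2 / 2 * n :=
        mul_le_mul_of_nonneg_right hκ hnp.le
      have h3 : 0 ≤ (ind (i = j) + ind (u i = j) + ind (v i = j)) * n := by positivity
      linarith
  have hsum : ∀ i : M, ∑ j ∈ I, ind (i = j) ≤ 1 := fun i => by
    rw [← sum_ind_eq i]
    exact Finset.sum_le_sum_of_subset_of_nonneg (Finset.subset_univ _) fun _ _ _ => ind_nonneg _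
  -- Each row of the Gram matrix has at most three exceptional entries, of size at most `n`, and the
  -- others are at most `e ^ 2 / 2 * n`. Half of `I.card * e ^ 2` is then absorbed on the left,
  -- which yields `6 / e ^ 2`.
  have key := card_mul_sq_le_of_gram I x (fun t => ind (o t = d)) (fun t => abs_ind_le_one _)
    (c := e) (B := 3 + I.card * (e ^ 2 / 2)) he.le (by positivity) hn
    (fun i hi => by
      refine (huv i hi).le.trans (le_of_eq ?_)
      congr 1
      exact Finset.sum_congr rfl fun t _ => by simp only [x]; ring)
    (fun i hi => by
      refine (Finset.sum_le_sum (hgram i)).trans ?_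
      rw [Finset.sum_add_distrib, ← Finset.sum_mul, Finset.sum_add_distrib,
        Finset.sum_add_distrib, Finset.sum_const, nsmul_eq_mul]
      have := hsum i
      have := hsum (u i)
      have := hsum (v i)
      nlinarith)
  rw [le_div_iff₀ (by positivity)]
  linarith

lemma card_biased_le [Fintype O] [Fintype M] {π : A → H}
    (hπ : ∀ h, ∑ α, (ind (π α = h) - 1 / (Fintype.card H : ℝ)) = 0)
    {F : M → Fin n → A} {κ e : ℝ} (hF : Decorrelated 5 F κ) (he : 0 < e)
    (hκ : (Fintype.card A : ℝ) ^ 6 * κ ≤ e ^ 2 / 2) (hn : 0 < n) (o : Fin n → O) :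
    ∑ i, ind (¬ Unbiased π F o e i) ≤
      Fintype.card (H × O × Set (A × A)) * (6 / e ^ 2) := by
  classical
  let bad (q : H × O × Set (A × A)) (i : M) : Prop := ∃ u v, u ≠ i ∧ v ≠ i ∧
      e * n < |∑ t, (ind (π (F i t) = q.1) - 1 / (Fintype.card H : ℝ)) *
        (ind (o t = q.2.1) * ind ((F u t, F v t) ∈ q.2.2))|
  have h1 : ∀ i, ind (¬ Unbiased π F o e i) ≤ ∑ q, ind (bad q i) := by
    intro i
    refine (ind_mono fun h => ?_).trans (ind_exists_le _)
    unfold Unbiased at h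
    push Not at h
    obtain ⟨u, v, hu, hv, a, d, G, h⟩ := h
    exact ⟨(a, d, G), u, v, hu, hv, h⟩
  refine (Finset.sum_le_sum fun i _ => h1 i).trans ?_
  rw [Finset.sum_comm]
  calc ∑ q, ∑ i, ind (bad q i) ≤ ∑ _q : H × O × Set (A × A), 6 / e ^ 2 := by
        refine Finset.sum_le_sum fun q _ => ?_
        have := card_biased_letter_le hπ hF he hκ hn o q.1 q.2.1 q.2.2
          (Finset.univ.filter (bad q)) (fun i hi => (Finset.mem_filter.1 hi).2)
        refine le_trans (le_of_eq ?_) this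
        simp only [ind, Finset.sum_boole]
        congr
    _ = _ := by rw [Finset.sum_const, Finset.card_univ, nsmul_eq_mul]

end Bias

/-! ### The true message is a candidate with high probability. -/

section Acceptance

variable {A H O Z M : Type*} [Fintype A] [Fintype H] [Fintype O] [Fintype Z] {n : ℕ}

/-- The output word `z` looks like the response of the channel to the word `π ∘ F i` of the honest
user and to the word `o` of the other user, also given any two other words of the codebook. -/
def Typical (W : MAC H O Z) (π : A → H) (F : M → Fin n → A) (e : ℝ) (i : M) (z : Fin n → Z)
    (o : Fin n → O) : Prop :=
  ∀ u v, u ≠ i → v ≠ i → ∀ (a : H) (d : O) (ζ : Z) (G : Set (A × A)),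
    |∑ t, ind (π (F i t) = a) * ind (o t = d) * ind ((F u t, F v t) ∈ G) * ind (z t = ζ) -
      1 / (Fintype.card H : ℝ) * W.prob (a, d) ζ *
        ∑ t, ind (o t = d) * ind ((F u t, F v t) ∈ G)| ≤ e * n

/-- The output word `z` can be explained by the codeword with index `i`. -/
def Candidate (W : MAC H O Z) (π : A → H) (F : M → Fin n → A) (e : ℝ) (i : M) (z : Fin n → Z) :
    Prop :=
  ∃ o, Typical W π F e i z o

lemma CondDist.prob_le_one {A B : Type*} [Fintype B] (P : CondDist A B) (a : A) (b : B) :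
    P.prob a b ≤ 1 := by
  rw [← P.sum_eq_one a]
  exact Finset.single_le_sum (fun b _ => P.nonneg a b) (Finset.mem_univ b)

omit [Fintype H] [Fintype O] in
lemma prodProb_eq_sum_ind (W : MAC H O Z) (S : Set (Fin n → Z)) (x : Fin n → H) (y : Fin n → O) :
    MAC.prodProb W S x y = ∑ z, ind (z ∈ S) * ∏ t, W.prob (x t, y t) (z t) := by
  classical
  refine Finset.sum_congr rfl fun z _ => ?_
  by_cases hz : z ∈ S
  · rw [Set.indicator_of_mem hz, ind_of_true hz, one_mul]
  · rw [Set.indicator_of_notMem hz, ind_of_false hz, zero_mul]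

omit [Fintype H] [Fintype O] in
lemma prodProb_nonneg (W : MAC H O Z) (S : Set (Fin n → Z)) (x : Fin n → H) (y : Fin n → O) :
    0 ≤ MAC.prodProb W S x y := by
  rw [prodProb_eq_sum_ind]
  exact Finset.sum_nonneg fun z _ => mul_nonneg (ind_nonneg _)
    (Finset.prod_nonneg fun t _ => W.nonneg _ _)

omit [Fintype H] [Fintype O] in
lemma prodProb_mono (W : MAC H O Z) {S T : Set (Fin n → Z)} (h : S ⊆ T) (x : Fin n → H)
    (y : Fin n → O) : MAC.prodProb W S x y ≤ MAC.prodProb W T x y := by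
  rw [prodProb_eq_sum_ind, prodProb_eq_sum_ind]
  exact Finset.sum_le_sum fun z _ => mul_le_mul_of_nonneg_right (ind_mono fun hz => h hz)
    (Finset.prod_nonneg fun t _ => W.nonneg _ _)

omit [Fintype H] [Fintype O] in
lemma prodProb_univ (W : MAC H O Z) (x : Fin n → H) (y : Fin n → O) :
    MAC.prodProb W Set.univ x y = 1 := by
  rw [prodProb_eq_sum_ind]
  simp only [ind_of_true (Set.mem_univ _), one_mul]
  rw [sum_prod_eq_prod_sum (fun t b => W.prob (x t, y t) b)]
  simp [W.sum_eq_one]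

omit [Fintype H] [Fintype O] in
lemma prodProb_le_one (W : MAC H O Z) (S : Set (Fin n → Z)) (x : Fin n → H) (y : Fin n → O) :
    MAC.prodProb W S x y ≤ 1 := by
  rw [← prodProb_univ W x y]; exact prodProb_mono W (Set.subset_univ _) x y

omit [Fintype H] [Fintype O] in
lemma prodProb_union_le (W : MAC H O Z) (S T : Set (Fin n → Z)) (x : Fin n → H) (y : Fin n → O) :
    MAC.prodProb W (S ∪ T) x y ≤ MAC.prodProb W S x y + MAC.prodProb W T x y := by
  simp only [prodProb_eq_sum_ind]
  rw [← Finset.sum_add_distrib]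
  refine Finset.sum_le_sum fun z _ => ?_
  rw [← add_mul]
  exact mul_le_mul_of_nonneg_right (ind_or_le _ _) (Finset.prod_nonneg fun t _ => W.nonneg _ _)

omit [Fintype H] [Fintype O] in
/-- Concentration of the channel output along any set of positions. -/
lemma prodProb_deviation_le (W : MAC H O Z) (x : Fin n → H) (y : Fin n → O) (ζ : Z)
    (g : Fin n → ℝ) (hg : ∀ t, |g t| ≤ 1) {e : ℝ} (he : 0 ≤ e) (he2 : e ≤ 2) :
    MAC.prodProb W {z | e * n < |∑ t, g t * (ind (z t = ζ) - W.prob (x t, y t) ζ)|} x y ≤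
      2 * Real.exp (-(n * e ^ 2 / 4)) := by
  rw [prodProb_eq_sum_ind]
  refine product_abs_tail_le (p := fun t b => W.prob (x t, y t) b)
    (h := fun t b => g t * (ind (b = ζ) - W.prob (x t, y t) ζ)) (fun t b => W.nonneg _ _)
    (fun t => W.sum_eq_one _) (fun t b => ?_) (fun t => ?_) he he2
  · rw [abs_mul]
    refine mul_le_one₀ (hg t) (abs_nonneg _) ?_
    have := W.nonneg (x t, y t) ζ
    have := W.prob_le_one (x t, y t) ζ
    have := ind_nonneg (b = ζ)
    have := ind_le_one (b = ζ)
    rw [abs_le]; constructor <;> linarith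
  · have h1 : ∀ b, W.prob (x t, y t) b * (g t * (ind (b = ζ) - W.prob (x t, y t) ζ)) =
        g t * (ind (ζ = b) * W.prob (x t, y t) b - W.prob (x t, y t) b * W.prob (x t, y t) ζ) := by
      intro b; rw [eq_comm (a := b)]; ring
    simp only [h1]
    rw [← Finset.mul_sum, Finset.sum_sub_distrib, sum_ind_eq_mul, ← Finset.sum_mul, W.sum_eq_one]
    ring

/-- The word `o` actually sent by the other user serves as the explanation. The deviation splits
into channel noise, controlled by Hoeffding and a union bound over all tests `q`, and the bias of
the codeword; each is allotted `e / 2`. -/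
lemma prodProb_not_candidate_le [Fintype M] (W : MAC H O Z) {π : A → H} {F : M → Fin n → A}
    {o : Fin n → O} {e : ℝ} (he : 0 ≤ e) (he2 : e ≤ 1) {i : M} (hi : Unbiased π F o (e / 2) i) :
    MAC.prodProb W {z | ¬ Candidate W π F e i z} (fun t => π (F i t)) o ≤
      Fintype.card (M × M × H × O × Z × Set (A × A)) *
        (2 * Real.exp (-(n * (e / 2) ^ 2 / 4))) := by
  classical
  let g (q : M × M × H × O × Z × Set (A × A)) (t : Fin n) : ℝ :=
    ind (π (F i t) = q.2.2.1) * ind (o t = q.2.2.2.1) *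
      ind ((F q.1 t, F q.2.1 t) ∈ q.2.2.2.2.2)
  let S (q : M × M × H × O × Z × Set (A × A)) : Set (Fin n → Z) :=
    {z | e / 2 * n < |∑ t, g q t * (ind (z t = q.2.2.2.2.1) -
      W.prob (π (F i t), o t) q.2.2.2.2.1)|}
  have hsub : ∀ z, ind (¬ Candidate W π F e i z) ≤ ∑ q, ind (z ∈ S q) := by
    intro z
    refine (ind_mono fun h => ?_).trans (ind_exists_le _)
    by_contra hno
    push Not at hno
    refine h ⟨o, fun u v hu hv a d ζ G => ?_⟩
    have h1 := hno (u, v, a, d, ζ, G)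
    simp only [S, g, Set.mem_ofPred_eq, not_lt] at h1
    have h2 := hi u v hu hv a d G
    have h3 : ∑ t, ind (π (F i t) = a) * ind (o t = d) * ind ((F u t, F v t) ∈ G) *
          ind (z t = ζ) - 1 / (Fintype.card H : ℝ) * W.prob (a, d) ζ *
          ∑ t, ind (o t = d) * ind ((F u t, F v t) ∈ G) =
        ∑ t, ind (π (F i t) = a) * ind (o t = d) * ind ((F u t, F v t) ∈ G) *
          (ind (z t = ζ) - W.prob (π (F i t), o t) ζ) +
        W.prob (a, d) ζ * ∑ t, (ind (π (F i t) = a) - 1 / (Fintype.card H : ℝ)) *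
          (ind (o t = d) * ind ((F u t, F v t) ∈ G)) := by
      rw [Finset.mul_sum, Finset.mul_sum, ← Finset.sum_sub_distrib, ← Finset.sum_add_distrib]
      refine Finset.sum_congr rfl fun t _ => ?_
      have h4 : ind (π (F i t) = a) * ind (o t = d) * W.prob (π (F i t), o t) ζ =
          ind (π (F i t) = a) * ind (o t = d) * W.prob (a, d) ζ := by
        by_cases c1 : π (F i t) = a
        · by_cases c2 : o t = d
          · rw [c1, c2]
          · rw [ind_of_false c2]; ring
        · rw [ind_of_false c1]; ring
      linear_combination ind ((F u t, F v t) ∈ G) * h4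
    rw [h3]
    refine (abs_add_le _ _).trans ?_
    have h5 : |W.prob (a, d) ζ * ∑ t, (ind (π (F i t) = a) - 1 / (Fintype.card H : ℝ)) *
        (ind (o t = d) * ind ((F u t, F v t) ∈ G))| ≤ e / 2 * n := by
      rw [abs_mul, abs_of_nonneg (W.nonneg _ _)]
      exact (mul_le_of_le_one_left (abs_nonneg _) (W.prob_le_one _ _)).trans h2
    linarith
  calc MAC.prodProb W {z | ¬ Candidate W π F e i z} (fun t => π (F i t)) o
      ≤ ∑ q, MAC.prodProb W (S q) (fun t => π (F i t)) o := by
        simp only [prodProb_eq_sum_ind]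
        rw [Finset.sum_comm]
        refine Finset.sum_le_sum fun z _ => ?_
        rw [← Finset.sum_mul]
        exact mul_le_mul_of_nonneg_right (hsub z) (Finset.prod_nonneg fun t _ => W.nonneg _ _)
    _ ≤ ∑ _q : M × M × H × O × Z × Set (A × A), 2 * Real.exp (-(n * (e / 2) ^ 2 / 4)) := by
        refine Finset.sum_le_sum fun q _ => prodProb_deviation_le W _ o _ (g q) (fun t => ?_)
          (by linarith) (by linarith)
        rw [abs_mul, abs_mul]
        exact mul_le_one₀ (mul_le_one₀ (abs_ind_le_one _) (abs_nonneg _) (abs_ind_le_one _))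
          (abs_nonneg _) (abs_ind_le_one _)
    _ = _ := by rw [Finset.sum_const, Finset.card_univ, nsmul_eq_mul]

/-- Against any word of the other user, all but boundedly many codewords are accepted with high
probability. -/
lemma sum_prodProb_not_candidate_le [Fintype M] (W : MAC H O Z) {π : A → H}
    (hπ : ∀ h, ∑ α, (ind (π α = h) - 1 / (Fintype.card H : ℝ)) = 0)
    {F : M → Fin n → A} {κ e : ℝ} (hF : Decorrelated 5 F κ) (he : 0 < e) (he2 : e ≤ 1)
    (hκ : (Fintype.card A : ℝ) ^ 6 * κ ≤ (e / 2) ^ 2 / 2) (hn : 0 < n)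
    (o : Fin n → O) {N : ℕ} (c : Fin N → M) (hc : Function.Injective c) :
    ∑ m, MAC.prodProb W {z | ¬ Candidate W π F e (c m) z} (fun t => π (F (c m) t)) o ≤
      Fintype.card (H × O × Set (A × A)) * (6 / (e / 2) ^ 2) +
      N * (Fintype.card (M × M × H × O × Z × Set (A × A)) *
        (2 * Real.exp (-(n * (e / 2) ^ 2 / 4)))) := by
  classical
  have h1 : ∀ m, MAC.prodProb W {z | ¬ Candidate W π F e (c m) z} (fun t => π (F (c m) t)) o ≤
      ind (¬ Unbiased π F o (e / 2) (c m)) +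
        Fintype.card (M × M × H × O × Z × Set (A × A)) *
        (2 * Real.exp (-(n * (e / 2) ^ 2 / 4))) := by
    intro m
    by_cases hm : Unbiased π F o (e / 2) (c m)
    · rw [ind_of_false (not_not.2 hm), zero_add]
      exact prodProb_not_candidate_le W he.le he2 hm
    · rw [ind_of_true hm]
      have := prodProb_le_one W {z | ¬ Candidate W π F e (c m) z} (fun t => π (F (c m) t)) o
      have h3 : 0 ≤ Fintype.card (M × M × H × O × Z × Set (A × A)) *
        (2 * Real.exp (-(n * (e / 2) ^ 2 / 4))) := by positivity
      linarith
  refine (Finset.sum_le_sum fun m _ => h1 m).trans ?_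
  rw [Finset.sum_add_distrib, Finset.sum_const, Finset.card_univ, Fintype.card_fin, nsmul_eq_mul]
  refine add_le_add_left ?_ _
  refine le_trans ?_ (card_biased_le hπ hF (half_pos he) hκ hn o)
  -- Injectivity of `c` makes the messages distinct codebook indices, so the bound on biased indices
  -- also bounds biased messages.
  rw [← Finset.sum_image (f := fun i => ind (¬ Unbiased π F o (e / 2) i))
    (fun a _ b _ h => hc h)]
  exact Finset.sum_le_sum_of_subset_of_nonneg (Finset.subset_univ _) fun _ _ _ => ind_nonneg _

end Acceptance

/-! ### A positive lower bound on the violation of the spoofing equations. -/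

section Gap

variable {X Y Z : Type*} [Fintype X] [Fintype Y] [Fintype Z]

/-- The channel with the roles of the users exchanged. -/
def MAC.swap (W : MAC X Y Z) : MAC Y X Z where
  prob p := W.prob (p.2, p.1)
  nonneg _ := W.nonneg _
  sum_eq_one _ := W.sum_eq_one _

/-- The total violation of the (unsymmetrized) spoofing equations. -/
def spoofDefect (W : MAC X Y Z) (U U' : X × Y → Y → ℝ) (V : X × X → X → ℝ) : ℝ :=
  ∑ a, ∑ b, ∑ c, ∑ z,
    (|∑ y, U (b, c) y * W.prob (a, y) z - ∑ x, V (a, b) x * W.prob (x, c) z| +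
     |∑ y, U' (a, c) y * W.prob (b, y) z - ∑ x, V (a, b) x * W.prob (x, c) z|)

/-- Averaging `U` with `U'`, and `V` with its transpose, symmetrizes the equations: the common
right-hand side becomes symmetric in the two letters of user 1, so one identity yields both spoofing
equations. -/
lemma spoofable1_of_spoofDefect_eq_zero (W : MAC X Y Z) (U U' : CondDist (X × Y) Y)
    (V : CondDist (X × X) X) (h : spoofDefect W U.prob U'.prob V.prob = 0) : Spoofable1 W := by
  have h1 : ∀ a b c z, ∑ y, U.prob (b, c) y * W.prob (a, y) z =
      ∑ x, V.prob (a, b) x * W.prob (x, c) z ∧ ∑ y, U'.prob (a, c) y * W.prob (b, y) z =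
      ∑ x, V.prob (a, b) x * W.prob (x, c) z := by
    intro a b c z
    unfold spoofDefect at h
    rw [Finset.sum_eq_zero_iff_of_nonneg fun _ _ => by positivity] at h
    have h := h a (Finset.mem_univ _)
    rw [Finset.sum_eq_zero_iff_of_nonneg fun _ _ => by positivity] at h
    have h := h b (Finset.mem_univ _)
    rw [Finset.sum_eq_zero_iff_of_nonneg fun _ _ => by positivity] at h
    have h := h c (Finset.mem_univ _)
    rw [Finset.sum_eq_zero_iff_of_nonneg fun _ _ => by positivity] at h
    have h := h z (Finset.mem_univ _)
    rw [add_eq_zero_iff_of_nonneg (abs_nonneg _) (abs_nonneg _), abs_eq_zero, abs_eq_zero,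
      sub_eq_zero, sub_eq_zero] at h
    exact h
  refine ⟨⟨fun p y => (U.prob p y + U'.prob p y) / 2, fun p y => ?_, fun p => ?_⟩,
    ⟨fun p x => (V.prob p x + V.prob p.swap x) / 2, fun p y => ?_, fun p => ?_⟩, ?_⟩
  · have := U.nonneg p y
    have := U'.nonneg p y
    positivity
  · rw [← Finset.sum_div, Finset.sum_add_distrib, U.sum_eq_one, U'.sum_eq_one]; norm_num
  · have := V.nonneg p y
    have := V.nonneg p.swap y
    positivity
  · rw [← Finset.sum_div, Finset.sum_add_distrib, V.sum_eq_one, V.sum_eq_one]; norm_num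
  · intro x' xt yt z
    have e1 : ∀ a b : X, ∑ y, (U.prob (b, yt) y + U'.prob (b, yt) y) / 2 * W.prob (a, y) z =
        ∑ x, (V.prob (b, a) x + V.prob (a, b) x) / 2 * W.prob (x, yt) z := by
      intro a b
      have h2 := (h1 a b yt z).1
      have h3 := (h1 b a yt z).2
      have h4 : ∀ y, (U.prob (b, yt) y + U'.prob (b, yt) y) / 2 * W.prob (a, y) z =
          (U.prob (b, yt) y * W.prob (a, y) z + U'.prob (b, yt) y * W.prob (a, y) z) / 2 :=
        fun y => by ring
      have h5 : ∀ x, (V.prob (b, a) x + V.prob (a, b) x) / 2 * W.prob (x, yt) z =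
          (V.prob (a, b) x * W.prob (x, yt) z + V.prob (b, a) x * W.prob (x, yt) z) / 2 :=
        fun y => by ring
      simp only [h4, h5]
      rw [← Finset.sum_div, ← Finset.sum_div, Finset.sum_add_distrib, Finset.sum_add_distrib,
        h2, h3]
    refine ⟨?_, ?_⟩
    · rw [e1, e1]
      exact Finset.sum_congr rfl fun x _ => by rw [add_comm]
    · rw [e1]
      exact Finset.sum_congr rfl fun x _ => by rw [add_comm]; rfl

/-- By compactness, the spoofing equations are violated by a fixed amount. -/
lemma exists_le_spoofDefect (W : MAC X Y Z) (h : ¬ Spoofable1 W) :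
    ∃ η > 0, ∀ (U U' : CondDist (X × Y) Y) (V : CondDist (X × X) X),
      η ≤ spoofDefect W U.prob U'.prob V.prob := by
  let K := (X × Y → stdSimplex ℝ Y) × (X × Y → stdSimplex ℝ Y) × (X × X → stdSimplex ℝ X)
  let f : K → ℝ := fun q => spoofDefect W (fun p y => (q.1 p : Y → ℝ) y)
    (fun p y => (q.2.1 p : Y → ℝ) y) (fun p x => (q.2.2 p : X → ℝ) x)
  have hof : ∀ (U U' : CondDist (X × Y) Y) (V : CondDist (X × X) X),
      ∃ q : K, f q = spoofDefect W U.prob U'.prob V.prob := fun U U' V =>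
    ⟨(fun p => ⟨U.prob p, U.nonneg p, U.sum_eq_one p⟩,
      fun p => ⟨U'.prob p, U'.nonneg p, U'.sum_eq_one p⟩,
      fun p => ⟨V.prob p, V.nonneg p, V.sum_eq_one p⟩), rfl⟩
  rcases isEmpty_or_nonempty K with hK | hK
  -- Any triple of conditional distributions would be a point of `K`, so here the bound is vacuous
  -- and the value 1 arbitrary.
  · exact ⟨1, one_pos, fun U U' V => (hK.false (hof U U' V).choose).elim⟩
  have hcy : ∀ (g : K → stdSimplex ℝ Y) (y : Y), Continuous g →
      Continuous fun q => (g q : Y → ℝ) y := fun g y hg =>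
    (continuous_apply y).comp (continuous_subtype_val.comp hg)
  have hcx : ∀ (g : K → stdSimplex ℝ X) (x : X), Continuous g →
      Continuous fun q => (g q : X → ℝ) x := fun g y hg =>
    (continuous_apply y).comp (continuous_subtype_val.comp hg)
  have hf : Continuous f := by
    simp only [f, spoofDefect]
    refine continuous_finsetSum _ fun a _ => continuous_finsetSum _ fun b _ =>
      continuous_finsetSum _ fun c _ => continuous_finsetSum _ fun z _ => ?_
    have c1 : Continuous fun q : K => ∑ y, (q.1 (b, c) : Y → ℝ) y * W.prob (a, y) z :=
      continuous_finsetSum _ fun y _ => (hcy _ y ((continuous_apply (b, c)).comp continuous_fst)).mul_const _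
    have c2 : Continuous fun q : K => ∑ y, (q.2.1 (a, c) : Y → ℝ) y * W.prob (b, y) z :=
      continuous_finsetSum _ fun y _ => (hcy _ y ((continuous_apply (a, c)).comp (continuous_fst.comp continuous_snd))).mul_const _
    have c3 : Continuous fun q : K => ∑ x, (q.2.2 (a, b) : X → ℝ) x * W.prob (x, c) z :=
      continuous_finsetSum _ fun y _ => (hcx _ y ((continuous_apply (a, b)).comp (continuous_snd.comp continuous_snd))).mul_const _
    exact (c1.sub c3).abs.add (c2.sub c3).abs
  have : CompactSpace K := by
    have : CompactSpace (stdSimplex ℝ Y) := isCompact_iff_compactSpace.1 (isCompact_stdSimplex ℝ Y)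
    have : CompactSpace (stdSimplex ℝ X) := isCompact_iff_compactSpace.1 (isCompact_stdSimplex ℝ X)
    infer_instance
  obtain ⟨q, -, hq⟩ := isCompact_univ.exists_isMinOn Set.univ_nonempty hf.continuousOn
  have hq0 : 0 ≤ f q := by
    simp only [f, spoofDefect]
    positivity
  refine ⟨f q, lt_of_le_of_ne hq0 fun h0 => h ?_, fun U U' V => ?_⟩
  · exact spoofable1_of_spoofDefect_eq_zero W ⟨_, fun p => (q.1 p).2.1, fun p => (q.1 p).2.2⟩
      ⟨_, fun p => (q.2.1 p).2.1, fun p => (q.2.1 p).2.2⟩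
      ⟨_, fun p => (q.2.2 p).2.1, fun p => (q.2.2 p).2.2⟩ h0.symm
  · obtain ⟨q', hq'⟩ := hof U U' V
    rw [← hq']
    exact hq (Set.mem_univ q')

end Gap

/-! ### Three candidates over both users solve the spoofing equations approximately. -/

section Confusion

variable {A H O Z M : Type*} [Fintype A] [Fintype H] [Fintype O] [Fintype Z] {n : ℕ}

/-- The words `π ∘ F u` and `π' ∘ F v` have nearly uniform joint type. -/
lemma Decorrelated.abs_pair_sub_le {H' : Type*} [Fintype H'] {π : A → H} {π' : A → H'}
    (hπ : ∀ h, ∑ α, (ind (π α = h) - 1 / (Fintype.card H : ℝ)) = 0)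
    (hπ' : ∀ h, ∑ α, (ind (π' α = h) - 1 / (Fintype.card H' : ℝ)) = 0)
    {F : M → Fin n → A} {κ : ℝ} (hF : Decorrelated 5 F κ) {u v : M} (huv : u ≠ v)
    (b : H) (c : H') :
    |∑ t, ind (π (F u t) = b ∧ π' (F v t) = c) -
      1 / (Fintype.card H : ℝ) * (1 / (Fintype.card H' : ℝ)) * n| ≤
      2 * (Fintype.card A : ℝ) ^ 6 * κ * n := by
  have h1 := hF.abs_sum_le (i := u) (J := fun _ => v) (fun _ => huv.symm)
    (f := fun α => ind (π α = b) - 1 / (Fintype.card H : ℝ))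
    (fun α => abs_ind_sub_inv_card_le_one _ _) (hπ b) (g := fun τ => ind (π' (τ 0) = c))
    (fun τ => abs_ind_le_one _)
  have h2 := hF.abs_sum_le (i := v) (J := fun _ => u) (fun _ => huv)
    (f := fun α => ind (π' α = c) - 1 / (Fintype.card H' : ℝ))
    (fun α => abs_ind_sub_inv_card_le_one _ _) (hπ' c) (g := fun _ => 1) (fun τ => by simp)
  have h3 : ∑ t, ind (π (F u t) = b ∧ π' (F v t) = c) -
      1 / (Fintype.card H : ℝ) * (1 / (Fintype.card H' : ℝ)) * n =
      ∑ t, (ind (π (F u t) = b) - 1 / (Fintype.card H : ℝ)) * ind (π' (F v t) = c) +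
      1 / (Fintype.card H : ℝ) * ∑ t, (ind (π' (F v t) = c) - 1 / (Fintype.card H' : ℝ)) * 1 := by
    simp only [← ind_mul_ind, sub_mul, mul_one, Finset.sum_sub_distrib, ← Finset.mul_sum,
      Finset.sum_const, Finset.card_univ, Fintype.card_fin, nsmul_eq_mul]
    ring
  rw [h3]
  refine (abs_add_le _ _).trans ?_
  have h4 : |1 / (Fintype.card H : ℝ) *
      ∑ t, (ind (π' (F v t) = c) - 1 / (Fintype.card H' : ℝ)) * 1| ≤
      (Fintype.card A : ℝ) ^ (5 + 1) * κ * n := by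
    rw [abs_mul]
    refine (mul_le_of_le_one_left (abs_nonneg _) ?_).trans h2
    simpa [ind] using abs_ind_sub_inv_card_le_one False (Fintype.card H)
  linarith

omit [Fintype A] in
/-- A candidate explains the output by a channel from the other two words to the word of the
other user. -/
lemma Candidate.exists_condDist [Nonempty O] {W : MAC H O Z} {π : A → H} {F : M → Fin n → A}
    {e : ℝ} {i : M} {z : Fin n → Z} (h : Candidate W π F e i z) {u v : M} (hu : u ≠ i)
    (hv : v ≠ i) :
    ∃ U : CondDist (Set (A × A)) O, ∀ (a : H) (ζ : Z) (G : Set (A × A)),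
      |∑ t, ind (π (F i t) = a) * ind ((F u t, F v t) ∈ G) * ind (z t = ζ) -
        1 / (Fintype.card H : ℝ) * (∑ t, ind ((F u t, F v t) ∈ G)) *
          ∑ d, U.prob G d * W.prob (a, d) ζ| ≤ Fintype.card O * e * n := by
  classical
  obtain ⟨o, ho⟩ := h
  let N (G : Set (A × A)) : ℝ := ∑ t, ind ((F u t, F v t) ∈ G)
  let L (G : Set (A × A)) (d : O) : ℝ := ∑ t, ind (o t = d) * ind ((F u t, F v t) ∈ G)
  have hL0 : ∀ G d, 0 ≤ L G d := fun G d =>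
    Finset.sum_nonneg fun t _ => mul_nonneg (ind_nonneg _) (ind_nonneg _)
  have hLN : ∀ G, ∑ d, L G d = N G := fun G => by
    simp only [L, N]
    rw [Finset.sum_comm]
    refine Finset.sum_congr rfl fun t _ => ?_
    rw [← Finset.sum_mul, sum_ind_eq, one_mul]
  have hN0 : ∀ G, 0 ≤ N G := fun G => by
    rw [← hLN]; exact Finset.sum_nonneg fun d _ => hL0 G d
  have hO : (Fintype.card O : ℝ) ≠ 0 := by exact_mod_cast Fintype.card_ne_zero
  -- The witness is the empirical law of the letters of `o` over the positions where the pair lies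
  -- in `G`. Without such positions the uniform law is a harmless default, since every `L G d` is
  -- zero too.
  refine ⟨⟨fun G d => if N G = 0 then 1 / (Fintype.card O : ℝ) else L G d / N G,
    fun G d => ?_, fun G => ?_⟩, fun a ζ G => ?_⟩
  · split_ifs
    · positivity
    · exact div_nonneg (hL0 _ _) (hN0 _)
  · split_ifs with h0
    · simp [hO]
    · rw [← Finset.sum_div, hLN, div_self h0]
  · have hNU : ∀ d, N G * (if N G = 0 then 1 / (Fintype.card O : ℝ) else L G d / N G) = L G d := by
      intro d
      split_ifs with h0
      · have h1 := hLN G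
        rw [h0, Finset.sum_eq_zero_iff_of_nonneg fun d _ => hL0 G d] at h1
        rw [h0, h1 d (Finset.mem_univ _), zero_mul]
      · field_simp
    have hsplit : ∑ t, ind (π (F i t) = a) * ind ((F u t, F v t) ∈ G) * ind (z t = ζ) -
        1 / (Fintype.card H : ℝ) * (∑ t, ind ((F u t, F v t) ∈ G)) *
          ∑ d, (if N G = 0 then 1 / (Fintype.card O : ℝ) else L G d / N G) * W.prob (a, d) ζ =
        ∑ d, (∑ t, ind (π (F i t) = a) * ind (o t = d) * ind ((F u t, F v t) ∈ G) *
          ind (z t = ζ) - 1 / (Fintype.card H : ℝ) * W.prob (a, d) ζ * L G d) := by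
      rw [Finset.sum_sub_distrib, Finset.sum_comm, Finset.mul_sum]
      congr 1
      · refine Finset.sum_congr rfl fun t _ => ?_
        rw [← sum_ind_eq_mul (o t) (fun _ => ind (π (F i t) = a) *
          ind ((F u t, F v t) ∈ G) * ind (z t = ζ))]
        exact Finset.sum_congr rfl fun d _ => by ring
      · refine Finset.sum_congr rfl fun d _ => ?_
        change 1 / (Fintype.card H : ℝ) * N G * _ = _
        linear_combination 1 / (Fintype.card H : ℝ) * W.prob (a, d) ζ * hNU d
    refine (le_of_eq (congrArg abs hsplit)).trans ((Finset.abs_sum_le_sum_abs _ _).trans ?_)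
    refine (Finset.sum_le_sum fun d _ => ho u v hu hv a d ζ G).trans (le_of_eq ?_)
    rw [Finset.sum_const, Finset.card_univ, nsmul_eq_mul]
    ring

lemma CondDist.sum_mul_mem_Icc {A B : Type*} [Fintype B] (P : CondDist A B) (a : A) {g : B → ℝ}
    (hg : ∀ b, 0 ≤ g b) (hg1 : ∀ b, g b ≤ 1) : ∑ b, P.prob a b * g b ∈ Set.Icc (0 : ℝ) 1 := by
  refine ⟨Finset.sum_nonneg fun b _ => mul_nonneg (P.nonneg a b) (hg b), ?_⟩
  rw [← P.sum_eq_one a]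
  exact Finset.sum_le_sum fun b _ => mul_le_of_le_one_right (P.nonneg a b) (hg1 b)

/-- Two candidates of one user and a candidate of the other user cannot coexist. -/
lemma Candidate.not_confused [Nonempty H] [Nonempty O] {W : MAC H O Z} {η : ℝ}
    (hη : ∀ (U U' : CondDist (H × O) O) (V : CondDist (H × H) H),
      η ≤ spoofDefect W U.prob U'.prob V.prob)
    {π : A → H} {π' : A → O}
    (hπ : ∀ h, ∑ α, (ind (π α = h) - 1 / (Fintype.card H : ℝ)) = 0)
    (hπ' : ∀ h, ∑ α, (ind (π' α = h) - 1 / (Fintype.card O : ℝ)) = 0)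
    {F : M → Fin n → A} {κ e : ℝ} (hF : Decorrelated 5 F κ) (hn : 0 < n)
    (hκ : 2 * (Fintype.card A : ℝ) ^ 6 * κ ≤ e)
    (he : 2 * ((Fintype.card H : ℝ) ^ 2 * Fintype.card O) ^ 2 * Fintype.card Z *
      (Fintype.card H + Fintype.card O + 2) * e < η)
    {i₁ i₂ i₃ : M} (h12 : i₁ ≠ i₂) (h13 : i₁ ≠ i₃) (h23 : i₂ ≠ i₃) {z : Fin n → Z}
    (h1 : Candidate W π F e i₁ z) (h2 : Candidate W π F e i₂ z)
    (h3 : Candidate (MAC.swap W) π' F e i₃ z) : False := by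
  -- Each candidate is tested with the other two words as side information.
  obtain ⟨U, hU⟩ := h1.exists_condDist h12.symm h13.symm
  obtain ⟨U', hU'⟩ := h2.exists_condDist h12 h23.symm
  obtain ⟨V, hV⟩ := h3.exists_condDist h13 h23
  let Gx (b : H) (c : O) : Set (A × A) := {p | π p.1 = b ∧ π' p.2 = c}
  let Gv (a b : H) : Set (A × A) := {p | π p.1 = a ∧ π p.2 = b}
  let Q : CondDist (H × O) O := ⟨fun p => U.prob (Gx p.1 p.2), fun _ => U.nonneg _,
    fun _ => U.sum_eq_one _⟩
  let Q' : CondDist (H × O) O := ⟨fun p => U'.prob (Gx p.1 p.2), fun _ => U'.nonneg _,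
    fun _ => U'.sum_eq_one _⟩
  let R : CondDist (H × H) H := ⟨fun p => V.prob (Gv p.1 p.2), fun _ => V.nonneg _,
    fun _ => V.sum_eq_one _⟩
  have hnp : (0 : ℝ) < n := by exact_mod_cast hn
  set h : ℝ := (Fintype.card H : ℝ) with hh
  set k : ℝ := (Fintype.card O : ℝ) with hk
  have hpos : 0 < h := by rw [hh]; exact_mod_cast Fintype.card_pos
  have kpos : 0 < k := by rw [hk]; exact_mod_cast Fintype.card_pos
  have h_one : 1 / h ≤ 1 := by
    rw [div_le_one hpos, hh]; exact_mod_cast Nat.one_le_iff_ne_zero.2 Fintype.card_ne_zero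
  have k_one : 1 / k ≤ 1 := by
    rw [div_le_one kpos, hk]; exact_mod_cast Nat.one_le_iff_ne_zero.2 Fintype.card_ne_zero
  have hκn : 2 * (Fintype.card A : ℝ) ^ 6 * κ * n ≤ e * n :=
    mul_le_mul_of_nonneg_right hκ hnp.le
  -- Replaces the number `q` of positions with a given pair of letters by its nominal value `q' *
  -- n`, at cost `e * n`.
  have combine : ∀ {N p s q m q' : ℝ}, 0 ≤ p → p ≤ 1 → 0 ≤ s → s ≤ 1 → |N - p * q * s| ≤ m →
      |q - q' * n| ≤ e * n → |N - p * q' * n * s| ≤ m + e * n := by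
    intro N p s q m q' hp hp1 hs hs1 hN hq
    have : N - p * q' * n * s = (N - p * q * s) + p * s * (q - q' * n) := by ring
    rw [this]
    refine (abs_add_le _ _).trans (add_le_add hN ?_)
    rw [abs_mul, abs_of_nonneg (mul_nonneg hp hs)]
    exact (mul_le_of_le_one_left (abs_nonneg _) (mul_le_one₀ hp1 hs hs1)).trans hq
  have key : ∀ a b c ζ,
      |∑ y, Q.prob (b, c) y * W.prob (a, y) ζ - ∑ x, R.prob (a, b) x * W.prob (x, c) ζ| +
      |∑ y, Q'.prob (a, c) y * W.prob (b, y) ζ - ∑ x, R.prob (a, b) x * W.prob (x, c) ζ| ≤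
      2 * (h ^ 2 * k * ((h + k + 2) * e)) := by
    intro a b c ζ
    set S1 := ∑ y, Q.prob (b, c) y * W.prob (a, y) ζ with hS1
    set S2 := ∑ y, Q'.prob (a, c) y * W.prob (b, y) ζ with hS2
    set S3 := ∑ x, R.prob (a, b) x * W.prob (x, c) ζ with hS3
    -- The joint type of the three words and the output. The three candidates approximate this one
    -- number by `n / (h ^ 2 * k)` times `S1`, `S2` and `S3`, so these three sums nearly agree.
    set N : ℝ := ∑ t, ind (π (F i₁ t) = a) * ind (π (F i₂ t) = b) * ind (π' (F i₃ t) = c) *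
      ind (z t = ζ) with hN
    have b1 := Q.sum_mul_mem_Icc (b, c) (fun y => W.nonneg (a, y) ζ)
      (fun y => W.prob_le_one (a, y) ζ)
    have b2 := Q'.sum_mul_mem_Icc (a, c) (fun y => W.nonneg (b, y) ζ)
      (fun y => W.prob_le_one (b, y) ζ)
    have b3 := R.sum_mul_mem_Icc (a, b) (fun x => W.nonneg (x, c) ζ)
      (fun x => W.prob_le_one (x, c) ζ)
    have t1 : |N - 1 / h * (∑ t, ind (π (F i₂ t) = b ∧ π' (F i₃ t) = c)) * S1| ≤ k * e * n := by
      have e1 : N = ∑ t, ind (π (F i₁ t) = a) * ind (π (F i₂ t) = b ∧ π' (F i₃ t) = c) *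
          ind (z t = ζ) :=
        Finset.sum_congr rfl fun t _ => by rw [← ind_mul_ind]; ring
      rw [e1]
      have e2 := hU a ζ (Gx b c)
      simp only [Gx, Set.mem_ofPred_eq] at e2
      exact e2
    have t2 : |N - 1 / h * (∑ t, ind (π (F i₁ t) = a ∧ π' (F i₃ t) = c)) * S2| ≤ k * e * n := by
      have e1 : N = ∑ t, ind (π (F i₂ t) = b) * ind (π (F i₁ t) = a ∧ π' (F i₃ t) = c) *
          ind (z t = ζ) :=
        Finset.sum_congr rfl fun t _ => by rw [← ind_mul_ind]; ring
      rw [e1]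
      have e2 := hU' b ζ (Gx a c)
      simp only [Gx, Set.mem_ofPred_eq] at e2
      exact e2
    have t3 : |N - 1 / k * (∑ t, ind (π (F i₁ t) = a ∧ π (F i₂ t) = b)) * S3| ≤ h * e * n := by
      have e1 : N = ∑ t, ind (π' (F i₃ t) = c) * ind (π (F i₁ t) = a ∧ π (F i₂ t) = b) *
          ind (z t = ζ) :=
        Finset.sum_congr rfl fun t _ => by rw [← ind_mul_ind]; ring
      rw [e1]
      have e2 := hV c ζ (Gv a b)
      simp only [Gv, Set.mem_ofPred_eq] at e2
      exact e2
    have c1 := combine (by positivity) h_one b1.1 b1.2 t1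
      ((hF.abs_pair_sub_le hπ hπ' h23 b c).trans hκn)
    have c2 := combine (by positivity) h_one b2.1 b2.2 t2
      ((hF.abs_pair_sub_le hπ hπ' h13 a c).trans hκn)
    have c3 := combine (by positivity) k_one b3.1 b3.2 t3
      ((hF.abs_pair_sub_le hπ hπ h12 a b).trans hκn)
    have fin : ∀ S, |N - 1 / h * (1 / h * (1 / k)) * n * S| ≤ k * e * n + e * n →
        |S - S3| ≤ h ^ 2 * k * ((h + k + 2) * e) := by
      intro S hS
      have h4 : |(1 / h * (1 / h * (1 / k)) * n) * (S - S3)| ≤ (h + k + 2) * e * n := by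
        have : (1 / h * (1 / h * (1 / k)) * n) * (S - S3) =
            (N - 1 / k * (1 / h * (1 / h)) * n * S3) - (N - 1 / h * (1 / h * (1 / k)) * n * S) := by
          ring
        rw [this]
        refine (abs_sub _ _).trans ?_
        linarith
      rw [abs_mul, abs_of_nonneg (by positivity)] at h4
      have h5 : (1 / h * (1 / h * (1 / k)) * n) * |S - S3| =
          (|S - S3| / (h ^ 2 * k)) * n := by field_simp
      rw [h5] at h4
      have h6 := le_of_mul_le_mul_right h4 hnp
      rw [div_le_iff₀ (by positivity)] at h6
      linarith
    have f1 := fin S1 c1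
    have f2 := fin S2 c2
    linarith
  have htot : spoofDefect W Q.prob Q'.prob R.prob ≤
      2 * (h ^ 2 * k) ^ 2 * Fintype.card Z * (h + k + 2) * e := by
    unfold spoofDefect
    refine (Finset.sum_le_sum fun a _ => Finset.sum_le_sum fun b _ => Finset.sum_le_sum
      fun c _ => Finset.sum_le_sum fun ζ _ => key a b c ζ).trans (le_of_eq ?_)
    simp only [Finset.sum_const, Finset.card_univ, nsmul_eq_mul, ← hh, ← hk]
    ring
  have := hη Q Q' R
  linarith

end Confusion

/-! ### The spoofing attack. -/

section Converse

/-- Averages the cover inequality over all triples: each of the three terms is summed first over the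
variable of its honest user, where its average is at most `P`. The second term is the first with `a`
and `a'` exchanged. -/
lemma sum_weighted_le_of_three_cover {α β : Type*} [Fintype α] [Fintype β] {w : α → ℝ} {w' : β → ℝ}
    (hw : ∀ a, 0 ≤ w a) (hw' : ∀ b, 0 ≤ w' b) {f g : α → α → β → ℝ} {r : α → α → ℝ} {s s' P : ℝ}
    (hs : ∑ a, w a = s) (hs' : ∑ b, w' b = s')
    (hf : ∀ a' b, ∑ a, w a * f a a' b ≤ s * P) (hg : ∀ a a', ∑ b, w' b * g a a' b ≤ s' * P)
    (hr : ∀ a a' b, r a a' ≤ f a a' b + f a' a b + g a a' b) :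
    (∑ a, ∑ a', w a * w a' * r a a') * s' ≤ 3 * (s ^ 2 * s' * P) := by
  have h1 : ∑ a', ∑ b, w a' * w' b * ∑ a, w a * f a a' b ≤ s ^ 2 * s' * P := by
    calc ∑ a', ∑ b, w a' * w' b * ∑ a, w a * f a a' b ≤ ∑ a', ∑ b, w a' * w' b * (s * P) :=
          Finset.sum_le_sum fun a' _ => Finset.sum_le_sum fun b _ =>
            mul_le_mul_of_nonneg_left (hf a' b) (mul_nonneg (hw _) (hw' _))
      _ = s ^ 2 * s' * P := by
          simp only [← Finset.sum_mul, ← Finset.mul_sum, hs, hs']; ring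
  have h3 : ∑ a, ∑ a', w a * w a' * ∑ b, w' b * g a a' b ≤ s ^ 2 * s' * P := by
    calc ∑ a, ∑ a', w a * w a' * ∑ b, w' b * g a a' b ≤ ∑ a, ∑ a', w a * w a' * (s' * P) :=
          Finset.sum_le_sum fun a _ => Finset.sum_le_sum fun a' _ =>
            mul_le_mul_of_nonneg_left (hg a a') (mul_nonneg (hw _) (hw _))
      _ = s ^ 2 * s' * P := by
          simp only [← Finset.sum_mul, ← Finset.mul_sum, hs]; ring
  have h4 : (∑ a, ∑ a', w a * w a' * r a a') * s' ≤
      ∑ a, ∑ a', ∑ b, w a * w a' * w' b * (f a a' b + f a' a b + g a a' b) := by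
    rw [← hs', Finset.sum_mul]
    refine Finset.sum_le_sum fun a _ => ?_
    rw [Finset.sum_mul]
    refine Finset.sum_le_sum fun a' _ => ?_
    rw [Finset.mul_sum]
    refine Finset.sum_le_sum fun b _ => ?_
    rw [mul_right_comm]
    exact mul_le_mul_of_nonneg_left (hr a a' b) (mul_nonneg (mul_nonneg (hw _) (hw _)) (hw' _))
  have e1 : ∑ a, ∑ a', ∑ b, w a * w a' * w' b * f a a' b =
      ∑ a', ∑ b, w a' * w' b * ∑ a, w a * f a a' b := by
    rw [Finset.sum_comm]
    refine Finset.sum_congr rfl fun a' _ => ?_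
    rw [Finset.sum_comm]
    refine Finset.sum_congr rfl fun b _ => ?_
    rw [Finset.mul_sum]
    exact Finset.sum_congr rfl fun a _ => by ring
  have e2 : ∑ a, ∑ a', ∑ b, w a * w a' * w' b * f a' a b =
      ∑ a', ∑ b, w a' * w' b * ∑ a, w a * f a a' b := by
    refine Finset.sum_congr rfl fun a' _ => ?_
    rw [Finset.sum_comm]
    refine Finset.sum_congr rfl fun b _ => ?_
    rw [Finset.mul_sum]
    exact Finset.sum_congr rfl fun a _ => by ring
  have e3 : ∑ a, ∑ a', ∑ b, w a * w a' * w' b * g a a' b =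
      ∑ a, ∑ a', w a * w a' * ∑ b, w' b * g a a' b := by
    refine Finset.sum_congr rfl fun a _ => Finset.sum_congr rfl fun a' _ => ?_
    rw [Finset.mul_sum]
    exact Finset.sum_congr rfl fun b _ => by ring
  simp only [mul_add, Finset.sum_add_distrib] at h4
  rw [e1, e2, e3] at h4
  linarith

variable {X Y Z : Type*} [Fintype X] [Fintype Y] [Fintype Z] {n : ℕ}

omit [Fintype X] in
/-- The output distribution of the memoryless channel, if user 2 draws letters independently. -/
lemma sum_mul_prodProb (W : MAC X Y Z) (q : Fin n → Y → ℝ) (S : Set (Fin n → Z)) (x : Fin n → X) :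
    ∑ y : Fin n → Y, (∏ t, q t (y t)) * MAC.prodProb W S x y =
      ∑ z, ind (z ∈ S) * ∏ t, ∑ b, q t b * W.prob (x t, b) (z t) := by
  simp only [prodProb_eq_sum_ind, Finset.mul_sum]
  rw [Finset.sum_comm]
  refine Finset.sum_congr rfl fun z _ => ?_
  rw [← sum_prod_eq_prod_sum (fun t b => q t b * W.prob (x t, b) (z t)), Finset.mul_sum]
  refine Finset.sum_congr rfl fun y _ => ?_
  rw [Finset.prod_mul_distrib]
  ring

/-- Only the order of the conditioning pair of `Q` differs. This reduces everything about user 2 to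
user 1. -/
lemma spoofable1_swap_iff (W : MAC X Y Z) : Spoofable1 (MAC.swap W) ↔ Spoofable2 W := by
  constructor
  · rintro ⟨Q, Q', h⟩
    exact ⟨⟨fun p => Q.prob p.swap, fun _ => Q.nonneg _, fun _ => Q.sum_eq_one _⟩, Q',
      fun xt yt y' z => h y' yt xt z⟩
  · rintro ⟨Q, Q', h⟩
    exact ⟨⟨fun p => Q.prob p.swap, fun _ => Q.nonneg _, fun _ => Q.sum_eq_one _⟩, Q',
      fun x' xt yt z => h yt xt x' z⟩

/-- Over a 1-spoofable channel, at least one of three attacks succeeds. -/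
lemma Spoofable1.le_of_attack_le {W : MAC X Y Z} (hW : Spoofable1 W) {N₁ N₂ : ℕ} (hN₁ : 2 ≤ N₁)
    (hN₂ : 1 ≤ N₂) (e₁ : CondDist (Fin N₁) (Fin n → X)) (e₂ : CondDist (Fin N₂) (Fin n → Y))
    {S₁ : Fin N₁ → Set (Fin n → Z)} {S₂ : Fin N₂ → Set (Fin n → Z)}
    (hS : ∀ m m' k, m ≠ m' → ∀ z, z ∈ S₁ m ∨ z ∈ S₁ m' ∨ z ∈ S₂ k) {P : ℝ}
    (h₁ : ∀ y, ∑ m, ∑ x, e₁.prob m x * MAC.prodProb W (S₁ m) x y ≤ N₁ * P)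
    (h₂ : ∀ x, ∑ k, ∑ y, e₂.prob k y * MAC.prodProb W (S₂ k) x y ≤ N₂ * P) : 1 / 12 ≤ P := by
  obtain ⟨Q, Q', hQ⟩ := hW
  -- The common output probability of the three scenarios: `hDswap` exchanges the two words of user
  -- 1, `hD1` reads it as an attack by user 2, `hD2` as an attack by user 1.
  let D (x' xt : Fin n → X) (yt : Fin n → Y) (S : Set (Fin n → Z)) : ℝ :=
    ∑ z, ind (z ∈ S) * ∏ t, ∑ b, Q.prob (xt t, yt t) b * W.prob (x' t, b) (z t)
  have hDswap : ∀ x' xt yt S, D x' xt yt S = D xt x' yt S := fun x' xt yt S =>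
    Finset.sum_congr rfl fun z _ => by
      rw [Finset.prod_congr rfl fun t _ => (hQ (x' t) (xt t) (yt t) (z t)).1]
  have hD1 : ∀ x' xt yt S, D x' xt yt S =
      ∑ y, (∏ t, Q.prob (xt t, yt t) (y t)) * MAC.prodProb W S x' y := fun x' xt yt S =>
    (sum_mul_prodProb W (fun t => Q.prob (xt t, yt t)) S x').symm
  have hD2 : ∀ x' xt yt S, D x' xt yt S =
      ∑ x, (∏ t, Q'.prob (xt t, x' t) (x t)) * MAC.prodProb W S x yt := fun x' xt yt S => by
    refine Eq.trans ?_ (sum_mul_prodProb (MAC.swap W) (fun t => Q'.prob (xt t, x' t)) S yt).symm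
    refine Finset.sum_congr rfl fun z _ => ?_
    congr 1
    exact Finset.prod_congr rfl fun t _ =>
      (hQ (x' t) (xt t) (yt t) (z t)).1.trans (hQ (x' t) (xt t) (yt t) (z t)).2
  have hQ1 : ∀ xt : Fin n → X, ∀ yt : Fin n → Y,
      ∑ y : Fin n → Y, ∏ t, Q.prob (xt t, yt t) (y t) = 1 := fun xt yt => by
    rw [sum_prod_eq_prod_sum (fun t b => Q.prob (xt t, yt t) b)]
    simp [Q.sum_eq_one]
  have hQ1' : ∀ xt x' : Fin n → X,
      ∑ x : Fin n → X, ∏ t, Q'.prob (xt t, x' t) (x t) = 1 := fun xt yt => by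
    rw [sum_prod_eq_prod_sum (fun t b => Q'.prob (xt t, yt t) b)]
    simp [Q'.sum_eq_one]
  have hDone : ∀ x' xt yt (m m' : Fin N₁) (k : Fin N₂), 1 - ind (m = m') ≤
      D x' xt yt (S₁ m) + D xt x' yt (S₁ m') + D x' xt yt (S₂ k) := by
    intro x' xt yt m m' k
    have hpos : ∀ z : Fin n → Z,
        0 ≤ ∏ t, ∑ b, Q.prob (xt t, yt t) b * W.prob (x' t, b) (z t) := fun z =>
      Finset.prod_nonneg fun t _ => Finset.sum_nonneg fun b _ =>
        mul_nonneg (Q.nonneg _ _) (W.nonneg _ _)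
    have hD0 : ∀ S, 0 ≤ D x' xt yt S := fun S =>
      Finset.sum_nonneg fun z _ => mul_nonneg (ind_nonneg _) (hpos z)
    rw [← hDswap x' xt]
    by_cases hm : m = m'
    · rw [ind_of_true hm]
      have := hD0 (S₁ m)
      have := hD0 (S₁ m')
      have := hD0 (S₂ k)
      linarith
    · rw [ind_of_false hm, sub_zero]
      have huniv : D x' xt yt Set.univ = 1 := by
        rw [hD1]
        simp only [prodProb_univ, mul_one, hQ1]
      rw [← huniv]
      simp only [D]
      rw [← Finset.sum_add_distrib, ← Finset.sum_add_distrib]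
      refine Finset.sum_le_sum fun z _ => ?_
      rw [← add_mul, ← add_mul]
      refine mul_le_mul_of_nonneg_right ?_ (hpos z)
      refine (ind_mono fun _ => hS m m' k hm z).trans ((ind_or_le _ _).trans ?_)
      have := ind_or_le (z ∈ S₁ m') (z ∈ S₂ k)
      linarith
  have hA1 : ∀ xt yt, ∑ a : Fin N₁ × (Fin n → X), e₁.prob a.1 a.2 * D a.2 xt yt (S₁ a.1) ≤
      N₁ * P := by
    intro xt yt
    calc ∑ a : Fin N₁ × (Fin n → X), e₁.prob a.1 a.2 * D a.2 xt yt (S₁ a.1)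
        = ∑ y : Fin n → Y, (∏ t, Q.prob (xt t, yt t) (y t)) *
            ∑ m, ∑ x, e₁.prob m x * MAC.prodProb W (S₁ m) x y := by
          simp only [hD1, Fintype.sum_prod_type, Finset.mul_sum]
          conv_rhs => rw [Finset.sum_comm]
          refine Finset.sum_congr rfl fun m _ => ?_
          rw [Finset.sum_comm]
          exact Finset.sum_congr rfl fun y _ => Finset.sum_congr rfl fun x _ => by ring
      _ ≤ ∑ y : Fin n → Y, (∏ t, Q.prob (xt t, yt t) (y t)) * (N₁ * P) :=
          Finset.sum_le_sum fun y _ => mul_le_mul_of_nonneg_left (h₁ y)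
            (Finset.prod_nonneg fun t _ => Q.nonneg _ _)
      _ = N₁ * P := by rw [← Finset.sum_mul, hQ1, one_mul]
  have hA2 : ∀ x' xt, ∑ b : Fin N₂ × (Fin n → Y), e₂.prob b.1 b.2 * D x' xt b.2 (S₂ b.1) ≤
      N₂ * P := by
    intro x' xt
    calc ∑ b : Fin N₂ × (Fin n → Y), e₂.prob b.1 b.2 * D x' xt b.2 (S₂ b.1)
        = ∑ x : Fin n → X, (∏ t, Q'.prob (xt t, x' t) (x t)) *
            ∑ k, ∑ y, e₂.prob k y * MAC.prodProb W (S₂ k) x y := by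
          simp only [hD2, Fintype.sum_prod_type, Finset.mul_sum]
          conv_rhs => rw [Finset.sum_comm]
          refine Finset.sum_congr rfl fun m _ => ?_
          rw [Finset.sum_comm]
          exact Finset.sum_congr rfl fun y _ => Finset.sum_congr rfl fun x _ => by ring
      _ ≤ ∑ x : Fin n → X, (∏ t, Q'.prob (xt t, x' t) (x t)) * (N₂ * P) :=
          Finset.sum_le_sum fun y _ => mul_le_mul_of_nonneg_left (h₂ y)
            (Finset.prod_nonneg fun t _ => Q'.nonneg _ _)
      _ = N₂ * P := by rw [← Finset.sum_mul, hQ1', one_mul]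
  -- The variables are pairs of a message and an encoded word, so the adversary's fictitious
  -- messages are encoded by fresh copies of the honest encoders; this covers randomized codes.
  have key := sum_weighted_le_of_three_cover
    (w := fun a : Fin N₁ × (Fin n → X) => e₁.prob a.1 a.2)
    (w' := fun b : Fin N₂ × (Fin n → Y) => e₂.prob b.1 b.2)
    (fun a => e₁.nonneg _ _) (fun b => e₂.nonneg _ _)
    (f := fun a a' b => D a.2 a'.2 b.2 (S₁ a.1)) (g := fun a a' b => D a.2 a'.2 b.2 (S₂ b.1))
    (r := fun a a' => 1 - ind (a.1 = a'.1)) (s := N₁) (s' := N₂) (P := P)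
    (by simp [Fintype.sum_prod_type, e₁.sum_eq_one])
    (by simp [Fintype.sum_prod_type, e₂.sum_eq_one])
    (fun a' b => hA1 a'.2 b.2) (fun a a' => hA2 a.2 a'.2)
    (fun a a' b => hDone a.2 a'.2 b.2 a.1 a'.1 b.1)
  have hsum : ∑ a : Fin N₁ × (Fin n → X), ∑ a' : Fin N₁ × (Fin n → X),
      e₁.prob a.1 a.2 * e₁.prob a'.1 a'.2 * (1 - ind (a.1 = a'.1)) = (N₁ : ℝ) ^ 2 - N₁ := by
    have hin : ∀ a : Fin N₁ × (Fin n → X), ∑ a' : Fin N₁ × (Fin n → X),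
        e₁.prob a.1 a.2 * e₁.prob a'.1 a'.2 * (1 - ind (a.1 = a'.1)) =
        e₁.prob a.1 a.2 * (N₁ - 1) := by
      intro a
      have h0 : ∀ m, ∑ x, e₁.prob a.1 a.2 * e₁.prob m x * (1 - ind (a.1 = m)) =
          e₁.prob a.1 a.2 * (1 - ind (a.1 = m)) := fun m => by
        rw [← Finset.sum_mul, ← Finset.mul_sum, e₁.sum_eq_one, mul_one]
      rw [Fintype.sum_prod_type]
      simp only [h0]
      rw [← Finset.mul_sum, Finset.sum_sub_distrib, sum_ind_eq]
      simp
    simp only [hin]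
    rw [← Finset.sum_mul, Fintype.sum_prod_type]
    simp only [e₁.sum_eq_one]
    simp
    ring
  rw [hsum] at key
  have hN1 : (2 : ℝ) ≤ N₁ := by exact_mod_cast hN₁
  have hN2 : (1 : ℝ) ≤ N₂ := by exact_mod_cast hN₂
  by_contra hP
  push Not at hP
  -- With `N₁ ≥ 2` this already forces `P ≥ 1 / 6`, which is more than needed.
  have h5 : ((N₁ : ℝ) ^ 2 - N₁) ≤ 3 * (N₁ ^ 2 * P) := by
    refine le_of_mul_le_mul_right (a := (N₂ : ℝ)) ?_ (by linarith)
    linarith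
  nlinarith

end Converse

/-! ### The error events and the three attacks for actual codes. -/

section ErrorEvents

variable {X Y Z : Type*} {N₁ N₂ n : ℕ}

/-- A decoded message cannot have both `m` and `m'` as first entry, blaming user 1 is wrong when
user 1 is honest, and blaming user 2 is wrong when user 2 is honest. -/
lemma err1_or_err1_or_err2 (φ : Decoder Z N₁ N₂ n) {m m' : Fin N₁} (k : Fin N₂) (h : m ≠ m')
    (z : Fin n → Z) : z ∈ err1 φ m ∨ z ∈ err1 φ m' ∨ z ∈ err2 φ k := by
  simp only [err1, err2, Set.mem_ofPred_eq]
  rcases φ z with ⟨a, b⟩ | _ | _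
  · by_cases ha : a = m
    · subst ha
      simp [Decision.map, h]
    · simp [Decision.map, ha]
  · simp [Decision.map]
  · simp [Decision.map]

lemma err2_or_err2_or_err1 (φ : Decoder Z N₁ N₂ n) {k k' : Fin N₂} (m : Fin N₁) (h : k ≠ k')
    (z : Fin n → Z) : z ∈ err2 φ k ∨ z ∈ err2 φ k' ∨ z ∈ err1 φ m := by
  simp only [err1, err2, Set.mem_ofPred_eq]
  rcases φ z with ⟨a, b⟩ | _ | _
  · by_cases ha : b = k
    · subst ha
      simp [Decision.map, h]
    · simp [Decision.map, ha]
  · simp [Decision.map]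
  · simp [Decision.map]

variable [Fintype X] [Fintype Y] [Fintype Z]

/-- The point mass at the value of a function. -/
def CondDist.dirac {A B : Type*} [Fintype B] (f : A → B) : CondDist A B where
  prob a b := ind (f a = b)
  nonneg _ _ := ind_nonneg _
  sum_eq_one _ := sum_ind_eq _

lemma one_div_mul_le_iff {N : ℕ} (hN : 1 ≤ N) {s P : ℝ} : 1 / (N : ℝ) * s ≤ P ↔ s ≤ N * P := by
  have : (0 : ℝ) < N := by exact_mod_cast hN
  rw [one_div, inv_mul_le_iff₀ this]

lemma DetCode.sum_err1_le (c : DetCode X Y Z N₁ N₂ n) (W : MAC X Y Z) (hN : 1 ≤ N₁)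
    (y : Fin n → Y) :
    ∑ m, ∑ x, (CondDist.dirac c.enc1).prob m x * MAC.prodProb W (err1 c.dec m) x y ≤
      N₁ * c.error W := by
  simp only [CondDist.dirac, sum_ind_eq_mul]
  rw [← one_div_mul_le_iff hN]
  refine le_trans ?_ ((le_max_right _ _).trans (le_max_right _ _))
  exact le_ciSup (f := fun y => 1 / (N₁ : ℝ) * ∑ m, MAC.prodProb W (err1 c.dec m) (c.enc1 m) y)
    (Set.finite_range _).bddAbove y

lemma DetCode.sum_err2_le (c : DetCode X Y Z N₁ N₂ n) (W : MAC X Y Z) (hN : 1 ≤ N₂)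
    (x : Fin n → X) :
    ∑ m, ∑ y, (CondDist.dirac c.enc2).prob m y * MAC.prodProb W (err2 c.dec m) x y ≤
      N₂ * c.error W := by
  simp only [CondDist.dirac, sum_ind_eq_mul]
  rw [← one_div_mul_le_iff hN]
  refine le_trans ?_ ((le_max_left _ _).trans (le_max_right _ _))
  exact le_ciSup (f := fun x => 1 / (N₂ : ℝ) * ∑ m, MAC.prodProb W (err2 c.dec m) x (c.enc2 m))
    (Set.finite_range _).bddAbove x

/-- A linear functional on the simplex is bounded below by its values at the vertices. -/
lemma le_iSup_stdSimplex {B : Type*} [Fintype B] (g : B → ℝ) (b : B) :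
    g b ≤ ⨆ p : stdSimplex ℝ B, ∑ b, (p : B → ℝ) b * g b := by
  have hbdd : BddAbove (Set.range fun p : stdSimplex ℝ B => ∑ b, (p : B → ℝ) b * g b) := by
    refine ⟨∑ b, |g b|, ?_⟩
    rintro _ ⟨p, rfl⟩
    refine Finset.sum_le_sum fun b _ => ?_
    have h1 : (p : B → ℝ) b ≤ 1 := by
      rw [← p.2.2]
      exact Finset.single_le_sum (fun b _ => p.2.1 b) (Finset.mem_univ b)
    calc (p : B → ℝ) b * g b ≤ (p : B → ℝ) b * |g b| :=
          mul_le_mul_of_nonneg_left (le_abs_self _) (p.2.1 b)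
      _ ≤ |g b| := mul_le_of_le_one_left (abs_nonneg _) h1
  have := le_ciSup hbdd ⟨fun b' => ind (b = b'), fun _ => ind_nonneg _, sum_ind_eq b⟩
  exact (sum_ind_eq_mul b g).symm.le.trans this

lemma StochCode.sum_err1_le (c : StochCode X Y Z N₁ N₂ n) (W : MAC X Y Z) (hN : 1 ≤ N₁)
    (y : Fin n → Y) :
    ∑ m, ∑ x, c.enc1.prob m x * MAC.prodProb W (err1 c.dec m) x y ≤ N₁ * c.error W := by
  rw [← one_div_mul_le_iff hN]
  refine le_trans ?_ ((le_max_right _ _).trans (le_max_right _ _))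
  exact le_iSup_stdSimplex
    (fun y => 1 / (N₁ : ℝ) * ∑ m, ∑ x, c.enc1.prob m x * MAC.prodProb W (err1 c.dec m) x y) y

lemma StochCode.sum_err2_le (c : StochCode X Y Z N₁ N₂ n) (W : MAC X Y Z) (hN : 1 ≤ N₂)
    (x : Fin n → X) :
    ∑ m, ∑ y, c.enc2.prob m y * MAC.prodProb W (err2 c.dec m) x y ≤ N₂ * c.error W := by
  rw [← one_div_mul_le_iff hN]
  refine le_trans ?_ ((le_max_left _ _).trans (le_max_right _ _))
  exact le_iSup_stdSimplex
    (fun x => 1 / (N₂ : ℝ) * ∑ m, ∑ y, c.enc2.prob m y * MAC.prodProb W (err2 c.dec m) x y) x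

lemma Spoofable1.le_error {W : MAC X Y Z} (hW : Spoofable1 W) (hN₁ : 2 ≤ N₁) (hN₂ : 1 ≤ N₂) :
    (∀ c : DetCode X Y Z N₁ N₂ n, 1 / 12 ≤ c.error W) ∧
      (∀ c : StochCode X Y Z N₁ N₂ n, 1 / 12 ≤ c.error W) :=
  ⟨fun c => hW.le_of_attack_le hN₁ hN₂ _ _
      (fun _ _ k h z => err1_or_err1_or_err2 c.dec k h z)
      (c.sum_err1_le W (one_le_two.trans hN₁)) (c.sum_err2_le W hN₂),
    fun c => hW.le_of_attack_le hN₁ hN₂ _ _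
      (fun _ _ k h z => err1_or_err1_or_err2 c.dec k h z)
      (c.sum_err1_le W (one_le_two.trans hN₁)) (c.sum_err2_le W hN₂)⟩

lemma Spoofable2.le_error {W : MAC X Y Z} (hW : Spoofable2 W) (hN₁ : 1 ≤ N₁) (hN₂ : 2 ≤ N₂) :
    (∀ c : DetCode X Y Z N₁ N₂ n, 1 / 12 ≤ c.error W) ∧
      (∀ c : StochCode X Y Z N₁ N₂ n, 1 / 12 ≤ c.error W) := by
  rw [← spoofable1_swap_iff] at hW
  -- Output probabilities of the swapped channel are definitionally those of `W` with the words
  -- exchanged, so the bounds for `c` apply without transposing the code.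
  exact ⟨fun c => hW.le_of_attack_le hN₂ hN₁ _ _
      (fun _ _ k h z => err2_or_err2_or_err1 c.dec k h z)
      (c.sum_err2_le W (one_le_two.trans hN₂)) (c.sum_err1_le W hN₁),
    fun c => hW.le_of_attack_le hN₂ hN₁ _ _
      (fun _ _ k h z => err2_or_err2_or_err1 c.dec k h z)
      (c.sum_err2_le W (one_le_two.trans hN₂)) (c.sum_err1_le W hN₁)⟩

end ErrorEvents

/-! ### The decoder built from candidate sets. -/

section Decoding

variable {Z : Type*} {N₁ N₂ n : ℕ}

open scoped Classical in
/-- Decode to a pair of candidates, or blame a user without candidates. -/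
def candidateDecoder (A₁ : (Fin n → Z) → Set (Fin N₁)) (A₂ : (Fin n → Z) → Set (Fin N₂)) :
    Decoder Z N₁ N₂ n := fun z =>
  if h₁ : (A₁ z).Nonempty then
    if h₂ : (A₂ z).Nonempty then .message (h₁.some, h₂.some) else .blame2
  else .blame1

variable {A₁ : (Fin n → Z) → Set (Fin N₁)} {A₂ : (Fin n → Z) → Set (Fin N₂)}

/-- If `m` is a candidate, user 1 is not blamed: either user 2 has no candidate and is blamed, or
uniqueness makes the chosen first entry equal to `m`. -/
lemma err1_candidateDecoder_subset
    (h : ∀ z m m' k, m ∈ A₁ z → m' ∈ A₁ z → k ∈ A₂ z → m = m') (m : Fin N₁) :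
    err1 (candidateDecoder A₁ A₂) m ⊆ {z | m ∉ A₁ z} := by
  intro z hz hm
  have h₁ : (A₁ z).Nonempty := ⟨m, hm⟩
  simp only [err1, candidateDecoder, Set.mem_ofPred_eq, dif_pos h₁] at hz
  by_cases h₂ : (A₂ z).Nonempty
  · rw [dif_pos h₂] at hz
    refine hz.1 ?_
    rw [h z m _ _ hm h₁.some_mem h₂.some_mem]
    rfl
  · rw [dif_neg h₂] at hz
    exact hz.2 rfl

lemma err2_candidateDecoder_subset
    (h : ∀ z m k k', m ∈ A₁ z → k ∈ A₂ z → k' ∈ A₂ z → k = k') (k : Fin N₂) :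
    err2 (candidateDecoder A₁ A₂) k ⊆ {z | k ∉ A₂ z} := by
  intro z hz hk
  have h₂ : (A₂ z).Nonempty := ⟨k, hk⟩
  simp only [err2, candidateDecoder, Set.mem_ofPred_eq, dif_pos h₂] at hz
  by_cases h₁ : (A₁ z).Nonempty
  · rw [dif_pos h₁] at hz
    refine hz.1 ?_
    rw [h z _ k _ h₁.some_mem hk h₂.some_mem]
    rfl
  · rw [dif_neg h₁] at hz
    exact hz.2 rfl

lemma errHon_candidateDecoder_subset
    (h : ∀ z m m' k, m ∈ A₁ z → m' ∈ A₁ z → k ∈ A₂ z → m = m')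
    (h' : ∀ z m k k', m ∈ A₁ z → k ∈ A₂ z → k' ∈ A₂ z → k = k') (m : Fin N₁) (k : Fin N₂) :
    errHon (candidateDecoder A₁ A₂) m k ⊆ {z | m ∉ A₁ z} ∪ {z | k ∉ A₂ z} := by
  intro z hz
  by_contra hc
  simp only [Set.mem_union, Set.mem_ofPred_eq, not_or, not_not] at hc
  have h₁ : (A₁ z).Nonempty := ⟨m, hc.1⟩
  have h₂ : (A₂ z).Nonempty := ⟨k, hc.2⟩
  simp only [errHon, candidateDecoder, Set.mem_ofPred_eq, dif_pos h₁, dif_pos h₂] at hz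
  refine hz ?_
  rw [h z m _ _ hc.1 h₁.some_mem h₂.some_mem, h' z _ k _ h₁.some_mem hc.2 h₂.some_mem]

end Decoding

/-! ### Assembling the code. -/

section Achievability

variable {X Y Z : Type*} [Fintype X] [Fintype Y] [Fintype Z] {N₁ N₂ n : ℕ}

-- Every error requires a true message to be missing from its candidate set. As `h₁` and `h₂` hold
-- for arbitrary words of the other user, they also cover the case of two honest users, through a
-- union bound.
omit [Fintype X] [Fintype Y] in
lemma error_candidateDecoder_le (W : MAC X Y Z) (f₁ : Fin N₁ → Fin n → X) (f₂ : Fin N₂ → Fin n → Y)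
    {A₁ : (Fin n → Z) → Set (Fin N₁)} {A₂ : (Fin n → Z) → Set (Fin N₂)}
    (h : ∀ z m m' k, m ∈ A₁ z → m' ∈ A₁ z → k ∈ A₂ z → m = m')
    (h' : ∀ z m k k', m ∈ A₁ z → k ∈ A₂ z → k' ∈ A₂ z → k = k') (hN₁ : 1 ≤ N₁) (hN₂ : 1 ≤ N₂)
    {b₁ b₂ : ℝ} (hb₁ : 0 ≤ b₁) (hb₂ : 0 ≤ b₂)
    (h₁ : ∀ y, ∑ m, MAC.prodProb W {z | m ∉ A₁ z} (f₁ m) y ≤ N₁ * b₁)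
    (h₂ : ∀ x, ∑ k, MAC.prodProb W {z | k ∉ A₂ z} x (f₂ k) ≤ N₂ * b₂) :
    (DetCode.mk f₁ f₂ (candidateDecoder A₁ A₂)).error W ≤ b₁ + b₂ := by
  have hn1 : (0 : ℝ) < N₁ := by exact_mod_cast hN₁
  have hn2 : (0 : ℝ) < N₂ := by exact_mod_cast hN₂
  refine max_le ?_ (max_le ?_ ?_)
  · have h3 : ∑ m, ∑ k, MAC.prodProb W (errHon (candidateDecoder A₁ A₂) m k) (f₁ m) (f₂ k) ≤
        N₁ * N₂ * (b₁ + b₂) := by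
      calc ∑ m, ∑ k, MAC.prodProb W (errHon (candidateDecoder A₁ A₂) m k) (f₁ m) (f₂ k)
          ≤ ∑ m, ∑ k, (MAC.prodProb W {z | m ∉ A₁ z} (f₁ m) (f₂ k) +
              MAC.prodProb W {z | k ∉ A₂ z} (f₁ m) (f₂ k)) :=
            Finset.sum_le_sum fun m _ => Finset.sum_le_sum fun k _ =>
              (prodProb_mono W (errHon_candidateDecoder_subset h h' m k) _ _).trans
                (prodProb_union_le W _ _ _ _)
        _ = ∑ k, ∑ m, MAC.prodProb W {z | m ∉ A₁ z} (f₁ m) (f₂ k) +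
            ∑ m, ∑ k, MAC.prodProb W {z | k ∉ A₂ z} (f₁ m) (f₂ k) := by
            simp only [Finset.sum_add_distrib]
            rw [Finset.sum_comm]
        _ ≤ ∑ _k : Fin N₂, N₁ * b₁ + ∑ _m : Fin N₁, N₂ * b₂ :=
            add_le_add (Finset.sum_le_sum fun k _ => h₁ _) (Finset.sum_le_sum fun m _ => h₂ _)
        _ = N₁ * N₂ * (b₁ + b₂) := by simp; ring
    unfold DetCode.errorHon
    rw [one_div, inv_mul_le_iff₀ (by positivity)]
    exact h3
  · refine Real.iSup_le (fun x => ?_) (by positivity)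
    rw [one_div_mul_le_iff hN₂]
    have h3 : ∑ k, MAC.prodProb W (err2 (candidateDecoder A₁ A₂) k) x (f₂ k) ≤ N₂ * b₂ :=
      (Finset.sum_le_sum fun k _ =>
        prodProb_mono W (err2_candidateDecoder_subset h' k) _ _).trans (h₂ x)
    refine h3.trans (mul_le_mul_of_nonneg_left (by linarith) hn2.le)
  · refine Real.iSup_le (fun y => ?_) (by positivity)
    rw [one_div_mul_le_iff hN₁]
    have h3 : ∑ m, MAC.prodProb W (err1 (candidateDecoder A₁ A₂) m) (f₁ m) y ≤ N₁ * b₁ :=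
      (Finset.sum_le_sum fun m _ =>
        prodProb_mono W (err1_candidateDecoder_subset h m) _ _).trans (h₁ y)
    refine h3.trans (mul_le_mul_of_nonneg_left (by linarith) hn1.le)

lemma sum_ind_sub_eq_zero {S T : Type*} [Fintype S] [Fintype T] [Nonempty S] (s : S) :
    ∑ _q : T, ∑ a : S, (ind (a = s) - 1 / (Fintype.card S : ℝ)) = 0 := by
  have hS : (Fintype.card S : ℝ) ≠ 0 := by exact_mod_cast Fintype.card_ne_zero
  have h0 : ∑ a : S, (ind (a = s) - 1 / (Fintype.card S : ℝ)) = 0 := by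
    rw [Finset.sum_sub_distrib, Finset.sum_congr rfl fun a _ => by rw [eq_comm (a := a)],
      sum_ind_eq]
    simp [hS]
  rw [h0, Finset.sum_const_zero]

lemma sum_ind_fst_sub [Nonempty X] (x : X) :
    ∑ α : X × Y, (ind (α.1 = x) - 1 / (Fintype.card X : ℝ)) = 0 := by
  rw [Fintype.sum_prod_type, Finset.sum_comm]
  exact sum_ind_sub_eq_zero x

lemma sum_ind_snd_sub [Nonempty Y] (y : Y) :
    ∑ α : X × Y, (ind (α.2 = y) - 1 / (Fintype.card Y : ℝ)) = 0 := by
  rw [Fintype.sum_prod_type]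
  exact sum_ind_sub_eq_zero y

/-- A decorrelated codebook yields an adversary identifying code with small error. -/
lemma exists_code_of_decorrelated [Nonempty X] [Nonempty Y] {W : MAC X Y Z} {η₁ η₂ : ℝ}
    (hη₁ : ∀ (U U' : CondDist (X × Y) Y) (V : CondDist (X × X) X),
      η₁ ≤ spoofDefect W U.prob U'.prob V.prob)
    (hη₂ : ∀ (U U' : CondDist (Y × X) X) (V : CondDist (Y × Y) Y),
      η₂ ≤ spoofDefect (MAC.swap W) U.prob U'.prob V.prob)
    {κ e : ℝ} (he0 : 0 < e) (he1 : e ≤ 1)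
    (hκ : (Fintype.card (X × Y) : ℝ) ^ 6 * κ ≤ (e / 2) ^ 2 / 2)
    (hη₁e : 2 * ((Fintype.card X : ℝ) ^ 2 * Fintype.card Y) ^ 2 * Fintype.card Z *
      (Fintype.card X + Fintype.card Y + 2) * e < η₁)
    (hη₂e : 2 * ((Fintype.card Y : ℝ) ^ 2 * Fintype.card X) ^ 2 * Fintype.card Z *
      (Fintype.card Y + Fintype.card X + 2) * e < η₂)
    (hN₁ : 1 ≤ N₁) (hN₂ : 1 ≤ N₂) (hn : 0 < n) {F : Fin N₁ ⊕ Fin N₂ → Fin n → X × Y}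
    (hF : Decorrelated 5 F κ) :
    ∃ c : DetCode X Y Z N₁ N₂ n, c.error W ≤
      (Fintype.card (X × Y × Set ((X × Y) × (X × Y))) * (6 / (e / 2) ^ 2) / N₁ +
        Fintype.card (X × Y × Z × Set ((X × Y) × (X × Y))) * (2 * ((N₁ + N₂ : ℝ) ^ 2 *
          Real.exp (-(n * (e / 2) ^ 2 / 4))))) +
      (Fintype.card (Y × X × Set ((X × Y) × (X × Y))) * (6 / (e / 2) ^ 2) / N₂ +
        Fintype.card (Y × X × Z × Set ((X × Y) × (X × Y))) * (2 * ((N₁ + N₂ : ℝ) ^ 2 *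
          Real.exp (-(n * (e / 2) ^ 2 / 4))))) := by
  have hκ' : 2 * (Fintype.card (X × Y) : ℝ) ^ 6 * κ ≤ e := by nlinarith
  have hn1 : (0 : ℝ) < N₁ := by exact_mod_cast hN₁
  have hn2 : (0 : ℝ) < N₂ := by exact_mod_cast hN₂
  refine ⟨⟨fun m t => (F (.inl m) t).1, fun k t => (F (.inr k) t).2, candidateDecoder
    (fun z => {m | Candidate W Prod.fst F e (.inl m) z})
    (fun z => {k | Candidate (MAC.swap W) Prod.snd F e (.inr k) z})⟩,
    error_candidateDecoder_le W _ _ ?_ ?_ hN₁ hN₂ (by positivity) (by positivity) ?_ ?_⟩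
  · intro z m m' k hm hm' hk
    by_contra hne
    exact Candidate.not_confused hη₁ sum_ind_fst_sub sum_ind_snd_sub hF hn hκ' hη₁e
      (fun h => hne (Sum.inl_injective h)) Sum.inl_ne_inr Sum.inl_ne_inr hm hm' hk
  · intro z m k k' hm hk hk'
    by_contra hne
    exact Candidate.not_confused hη₂ sum_ind_snd_sub sum_ind_fst_sub hF hn hκ' hη₂e
      (fun h => hne (Sum.inr_injective h)) Sum.inr_ne_inl Sum.inr_ne_inl hk hk' hm
  · intro y
    refine (sum_prodProb_not_candidate_le W sum_ind_fst_sub hF he0 he1 hκ hn y Sum.inl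
      Sum.inl_injective).trans (le_of_eq ?_)
    simp only [Fintype.card_prod, Fintype.card_sum, Fintype.card_fin, Nat.cast_mul, Nat.cast_add]
    field_simp
  · intro x
    refine (sum_prodProb_not_candidate_le (MAC.swap W) sum_ind_snd_sub hF he0 he1 hκ hn x Sum.inr
      Sum.inr_injective).trans (le_of_eq ?_)
    simp only [Fintype.card_prod, Fintype.card_sum, Fintype.card_fin, Nat.cast_mul, Nat.cast_add]
    field_simp

/-! ### Asymptotics of the error bound and the choice of constants. -/

open Filter Topology

lemma tendsto_floor_rpow_atTop {R : ℝ} (hR : 0 < R) :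
    Tendsto (fun n : ℕ => (⌊(2 : ℝ) ^ ((n : ℝ) * R)⌋₊ : ℝ)) atTop atTop := by
  have h1 : Tendsto (fun n : ℕ => (2 : ℝ) ^ ((n : ℝ) * R)) atTop atTop := by
    have h2 : ∀ n : ℕ, (2 : ℝ) ^ ((n : ℝ) * R) = ((2 : ℝ) ^ R) ^ n := fun n => by
      rw [mul_comm, Real.rpow_mul_natCast (by norm_num)]
    simp only [h2]
    exact tendsto_pow_atTop_atTop_of_one_lt (Real.one_lt_rpow (by norm_num) hR)
  exact (tendsto_natCast_atTop_atTop.comp tendsto_nat_floor_atTop).comp h1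

lemma one_le_floor_rpow {R : ℝ} (hR : 0 < R) (n : ℕ) : 1 ≤ ⌊(2 : ℝ) ^ ((n : ℝ) * R)⌋₊ := by
  rw [Nat.one_le_floor_iff]
  exact Real.one_le_rpow (by norm_num) (by positivity)

lemma floor_rpow_le_exp {R δ : ℝ} (hR : R ≤ δ) (hδ : 0 ≤ δ) (n : ℕ) :
    (⌊(2 : ℝ) ^ ((n : ℝ) * R)⌋₊ : ℝ) ≤ Real.exp (n * δ) := by
  refine (Nat.floor_le (by positivity)).trans ?_
  rw [Real.rpow_def_of_pos (by norm_num), Real.exp_le_exp]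
  have h1 : Real.log 2 ≤ 1 := by linarith [Real.log_two_lt_d9]
  have h2 : 0 ≤ Real.log 2 := Real.log_nonneg (by norm_num)
  have h3 : (n : ℝ) * R ≤ n * δ := mul_le_mul_of_nonneg_left hR (by positivity)
  have h4 : (0 : ℝ) ≤ n * δ := by positivity
  nlinarith

lemma tendsto_pow_mul_exp_neg {R₁ R₂ δ c : ℝ} (h₁ : R₁ ≤ δ) (h₂ : R₂ ≤ δ) (hδ : 0 ≤ δ) (k : ℕ)
    (hc : k * δ < c) :
    Tendsto (fun n : ℕ => ((⌊(2 : ℝ) ^ ((n : ℝ) * R₁)⌋₊ : ℝ) + ⌊(2 : ℝ) ^ ((n : ℝ) * R₂)⌋₊) ^ k *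
      Real.exp (-(n * c))) atTop (𝓝 0) := by
  have h3 : Tendsto (fun n : ℕ => (2 : ℝ) ^ k * (Real.exp (k * δ - c)) ^ n) atTop (𝓝 0) := by
    rw [← mul_zero ((2 : ℝ) ^ k)]
    exact (tendsto_pow_atTop_nhds_zero_of_lt_one (Real.exp_pos _).le
      (by rw [← Real.exp_zero, Real.exp_lt_exp]; linarith)).const_mul _
  refine squeeze_zero (fun n => by positivity) (fun n => ?_) h3
  calc ((⌊(2 : ℝ) ^ ((n : ℝ) * R₁)⌋₊ : ℝ) + ⌊(2 : ℝ) ^ ((n : ℝ) * R₂)⌋₊) ^ k *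
        Real.exp (-(n * c)) ≤ (2 * Real.exp (n * δ)) ^ k * Real.exp (-(n * c)) := by
        have := floor_rpow_le_exp h₁ hδ n
        have := floor_rpow_le_exp h₂ hδ n
        refine mul_le_mul_of_nonneg_right (pow_le_pow_left₀ (by positivity) (by linarith) k)
          (Real.exp_pos _).le
    _ = (2 : ℝ) ^ k * (Real.exp (k * δ - c)) ^ n := by
        rw [mul_pow, ← Real.exp_nat_mul, ← Real.exp_nat_mul, mul_assoc, ← Real.exp_add]
        congr 2; ring

omit [Fintype X] [Fintype Y] in
lemma DetCode.error_nonneg (c : DetCode X Y Z N₁ N₂ n) (W : MAC X Y Z) : 0 ≤ c.error W := by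
  refine le_trans ?_ (le_max_left _ _)
  exact mul_nonneg (by positivity) (Finset.sum_nonneg fun _ _ => Finset.sum_nonneg fun _ _ =>
    prodProb_nonneg _ _ _ _)

-- Achievability asks for a code at every length; the lengths without a good code are filled with a
-- constant code, which does not affect the limit.
omit [Fintype X] [Fintype Y] in
lemma achievable_of_eventually [Nonempty X] [Nonempty Y] {W : MAC X Y Z} {R : ℝ × ℝ}
    (h1 : 0 ≤ R.1) (h2 : 0 ≤ R.2) {b : ℕ → ℝ} (hb : Tendsto b atTop (𝓝 0))
    (h : ∀ᶠ n : ℕ in atTop, ∃ c : DetCode X Y Z ⌊(2 : ℝ) ^ ((n : ℝ) * R.1)⌋₊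
      ⌊(2 : ℝ) ^ ((n : ℝ) * R.2)⌋₊ n, c.error W ≤ b n) : Achievable W R := by
  classical
  refine ⟨h1, h2, fun n => if hc : ∃ c : DetCode X Y Z ⌊(2 : ℝ) ^ ((n : ℝ) * R.1)⌋₊
      ⌊(2 : ℝ) ^ ((n : ℝ) * R.2)⌋₊ n, c.error W ≤ b n then hc.choose else
      ⟨fun _ _ => Classical.arbitrary X, fun _ _ => Classical.arbitrary Y, fun _ => .blame1⟩, ?_⟩
  refine squeeze_zero' (Eventually.of_forall fun n => DetCode.error_nonneg _ _) ?_ hb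
  filter_upwards [h] with n hn
  rw [dif_pos hn]
  exact hn.choose_spec

/-- With an empty input alphabet the spoofing equations hold vacuously. -/
lemma nonempty_of_not_spoofable1 {W : MAC X Y Z} (h : ¬ Spoofable1 W) :
    Nonempty X ∧ Nonempty Y := by
  classical
  have hX : Nonempty X := by
    by_contra hX
    rw [not_nonempty_iff] at hX
    exact h ⟨⟨fun p => isEmptyElim p.1, fun p => isEmptyElim p.1, fun p => isEmptyElim p.1⟩,
      ⟨fun p => isEmptyElim p.1, fun p => isEmptyElim p.1, fun p => isEmptyElim p.1⟩,
      fun x => isEmptyElim x⟩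
  refine ⟨hX, ?_⟩
  by_contra hY
  rw [not_nonempty_iff] at hY
  exact h ⟨⟨fun p => isEmptyElim p.2, fun p => isEmptyElim p.2, fun p => isEmptyElim p.2⟩,
    CondDist.dirac Prod.fst, fun _ _ y => isEmptyElim y⟩

/-- If the channel is not spoofable, then all sufficiently small positive rates are achievable. -/
lemma exists_forall_achievable {W : MAC X Y Z} (h₁ : ¬ Spoofable1 W) (h₂ : ¬ Spoofable2 W) :
    ∃ δ > 0, ∀ R₁ R₂, 0 < R₁ → R₁ < δ → 0 < R₂ → R₂ < δ → Achievable W (R₁, R₂) := by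
  obtain ⟨hX, hY⟩ := nonempty_of_not_spoofable1 h₁
  obtain ⟨η₁, hη₁, hgap₁⟩ := exists_le_spoofDefect W h₁
  obtain ⟨η₂, hη₂, hgap₂⟩ := exists_le_spoofDefect (MAC.swap W)
    (fun h => h₂ ((spoofable1_swap_iff W).1 h))
  set D₁ : ℝ := 2 * ((Fintype.card X : ℝ) ^ 2 * Fintype.card Y) ^ 2 * Fintype.card Z *
      (Fintype.card X + Fintype.card Y + 2) with hD₁
  set D₂ : ℝ := 2 * ((Fintype.card Y : ℝ) ^ 2 * Fintype.card X) ^ 2 * Fintype.card Z *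
      (Fintype.card Y + Fintype.card X + 2) with hD₂
  have hD₁0 : 0 ≤ D₁ := by positivity
  have hD₂0 : 0 ≤ D₂ := by positivity
  -- Small enough that the defect produced by three confusable candidates stays below both gaps; the
  -- added 1 in the denominators avoids division by zero.
  set e : ℝ := min 1 (min (η₁ / (D₁ + 1)) (η₂ / (D₂ + 1))) with he
  have he0 : 0 < e := by positivity
  have he1 : e ≤ 1 := min_le_left _ _
  have heη₁ : D₁ * e < η₁ := by
    have h3 : e ≤ η₁ / (D₁ + 1) := (min_le_right _ _).trans (min_le_left _ _)
    rw [le_div_iff₀ (by positivity)] at h3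
    linarith
  have heη₂ : D₂ * e < η₂ := by
    have h3 : e ≤ η₂ / (D₂ + 1) := (min_le_right _ _).trans (min_le_right _ _)
    rw [le_div_iff₀ (by positivity)] at h3
    linarith
  set a : ℝ := (Fintype.card (X × Y) : ℝ) with ha
  have ha1 : 1 ≤ a := by
    rw [ha]; exact_mod_cast Nat.one_le_iff_ne_zero.2 Fintype.card_ne_zero
  have ha6 : 1 ≤ a ^ 6 := one_le_pow₀ ha1
  -- Gives equality in the requirement `a ^ 6 * κ ≤ (e / 2) ^ 2 / 2`.
  set κ : ℝ := e ^ 2 / 8 / a ^ 6 with hκ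
  have hκ0 : 0 < κ := by positivity
  have hκa : a ^ 6 * κ = e ^ 2 / 8 := by rw [hκ]; field_simp
  have hκ2 : κ ≤ 2 := by nlinarith
  set c : ℝ := min (κ ^ 2 / 4) ((e / 2) ^ 2 / 4) with hc
  have hc0 : 0 < c := by positivity
  -- The union bounds cost the sixth power of the number of codewords for the codebook and the
  -- second for the decoder tests, so rates below `c / 7` leave a strictly negative exponent in
  -- both. Positive rates are needed for the terms `K / N₁` and `K / N₂`, which come from the biased
  -- codewords.
  refine ⟨c / 7, by positivity, fun R₁ R₂ hR₁ hR₁' hR₂ hR₂' => ?_⟩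
  set N₁ : ℕ → ℕ := fun n => ⌊(2 : ℝ) ^ ((n : ℝ) * R₁)⌋₊ with hN₁
  set N₂ : ℕ → ℕ := fun n => ⌊(2 : ℝ) ^ ((n : ℝ) * R₂)⌋₊ with hN₂
  have hlim2 : Tendsto (fun n : ℕ => ((N₁ n : ℝ) + N₂ n) ^ 2 *
      Real.exp (-(n * (e / 2) ^ 2 / 4))) atTop (𝓝 0) := by
    have := tendsto_pow_mul_exp_neg (c := (e / 2) ^ 2 / 4) hR₁'.le hR₂'.le (by positivity) 2 (by
      have := min_le_right (κ ^ 2 / 4) ((e / 2) ^ 2 / 4)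
      push_cast
      linarith)
    simpa only [mul_div_assoc] using this
  have hlim6 : Tendsto (fun n : ℕ => ((N₁ n : ℝ) + N₂ n) ^ 6 *
      Real.exp (-(n * κ ^ 2 / 4))) atTop (𝓝 0) := by
    have := tendsto_pow_mul_exp_neg (c := κ ^ 2 / 4) hR₁'.le hR₂'.le (by positivity) 6 (by
      have := min_le_left (κ ^ 2 / 4) ((e / 2) ^ 2 / 4)
      push_cast
      linarith)
    simpa only [mul_div_assoc] using this
  have hdiv : ∀ (K : ℝ) {R : ℝ}, 0 < R →
      Tendsto (fun n : ℕ => K / (⌊(2 : ℝ) ^ ((n : ℝ) * R)⌋₊ : ℝ)) atTop (𝓝 0) := fun K R hR =>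
    (tendsto_floor_rpow_atTop hR).const_div_atTop K
  have hb : ∀ (K L : ℝ) {R : ℝ}, 0 < R → Tendsto (fun n : ℕ =>
      K / (⌊(2 : ℝ) ^ ((n : ℝ) * R)⌋₊ : ℝ) + L * (2 * (((N₁ n : ℝ) + N₂ n) ^ 2 *
        Real.exp (-(n * (e / 2) ^ 2 / 4))))) atTop (𝓝 0) := fun K L R hR => by
    simpa using (hdiv K hR).add ((hlim2.const_mul 2).const_mul L)
  refine achievable_of_eventually hR₁.le hR₂.le
    (b := fun n => (Fintype.card (X × Y × Set ((X × Y) × (X × Y))) * (6 / (e / 2) ^ 2) / N₁ n +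
        Fintype.card (X × Y × Z × Set ((X × Y) × (X × Y))) * (2 * ((N₁ n + N₂ n : ℝ) ^ 2 *
          Real.exp (-(n * (e / 2) ^ 2 / 4))))) +
      (Fintype.card (Y × X × Set ((X × Y) × (X × Y))) * (6 / (e / 2) ^ 2) / N₂ n +
        Fintype.card (Y × X × Z × Set ((X × Y) × (X × Y))) * (2 * ((N₁ n + N₂ n : ℝ) ^ 2 *
          Real.exp (-(n * (e / 2) ^ 2 / 4)))))) ?_ ?_
  · have := (hb (Fintype.card (X × Y × Set ((X × Y) × (X × Y))) * (6 / (e / 2) ^ 2))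
      (Fintype.card (X × Y × Z × Set ((X × Y) × (X × Y)))) hR₁).add
      (hb (Fintype.card (Y × X × Set ((X × Y) × (X × Y))) * (6 / (e / 2) ^ 2))
      (Fintype.card (Y × X × Z × Set ((X × Y) × (X × Y)))) hR₂)
    rw [add_zero] at this
    exact this
  · have hsmall : ∀ᶠ n : ℕ in atTop, a ^ 6 * 2 * (((N₁ n : ℝ) + N₂ n) ^ 6 *
        Real.exp (-(n * κ ^ 2 / 4))) < 1 := by
      have h3 := hlim6.const_mul (a ^ 6 * 2)
      rw [mul_zero] at h3
      exact h3.eventually_lt_const one_pos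
    filter_upwards [hsmall, eventually_gt_atTop 0] with n hn hn0
    obtain ⟨F, hF⟩ := exists_decorrelated (A := X × Y) (M := Fin (N₁ n) ⊕ Fin (N₂ n)) (n := n)
      (k := 5) hκ0.le hκ2 (by
        rw [Fintype.card_sum, Fintype.card_fin, Fintype.card_fin, ← ha]
        push_cast
        linarith)
    exact exists_code_of_decorrelated hgap₁ hgap₂ he0 he1 (by rw [← ha, hκa]; linarith)
      heη₁ heη₂ (one_le_floor_rpow hR₁ n) (one_le_floor_rpow hR₂ n) hn0 hF

end Achievability

end ByzantineMAC

end

theorem theorem1 {X Y Z : Type*} [Fintype X] [Fintype Y] [Fintype Z]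
    (W : ByzantineMAC.MAC X Y Z) :
    (ByzantineMAC.Spoofable1 W →
      ∀ N₁ N₂ n : ℕ, 2 ≤ N₁ → 1 ≤ N₂ →
        (∀ c : ByzantineMAC.DetCode X Y Z N₁ N₂ n, 1 / 12 ≤ c.error W) ∧
        (∀ c : ByzantineMAC.StochCode X Y Z N₁ N₂ n, 1 / 12 ≤ c.error W)) ∧
    (ByzantineMAC.Spoofable2 W →
      ∀ N₁ N₂ n : ℕ, 1 ≤ N₁ → 2 ≤ N₂ →
        (∀ c : ByzantineMAC.DetCode X Y Z N₁ N₂ n, 1 / 12 ≤ c.error W) ∧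
        (∀ c : ByzantineMAC.StochCode X Y Z N₁ N₂ n, 1 / 12 ≤ c.error W)) ∧
    (¬ ByzantineMAC.Spoofable1 W → ¬ ByzantineMAC.Spoofable2 W →
      (interior (ByzantineMAC.capacityRegion W)).Nonempty ∧
      ∃ R₁ R₂ : ℝ, 0 < R₁ ∧ 0 < R₂ ∧ ByzantineMAC.Achievable W (R₁, R₂)) := by
  refine ⟨fun h N₁ N₂ n hN₁ hN₂ => h.le_error hN₁ hN₂,
    fun h N₁ N₂ n hN₁ hN₂ => h.le_error hN₁ hN₂, fun h₁ h₂ => ?_⟩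
  obtain ⟨δ, hδ, hach⟩ := ByzantineMAC.exists_forall_achievable h₁ h₂
  have hhalf : 0 < δ / 2 := by positivity
  have hlt : δ / 2 < δ := by linarith
  refine ⟨⟨(δ / 2, δ / 2), ?_⟩, δ / 2, δ / 2, hhalf, hhalf, hach _ _ hhalf hlt hhalf hlt⟩
  rw [mem_interior]
  refine ⟨Set.Ioo 0 δ ×ˢ Set.Ioo 0 δ, fun R hR => subset_closure ?_, isOpen_Ioo.prod isOpen_Ioo,
    ⟨hhalf, hlt⟩, hhalf, hlt⟩
  exact hach R.1 R.2 hR.1.1 hR.1.2 hR.2.1 hR.2.2
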